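/- **Setting.** A partition is *strict* if its parts are pairwise distinct and *odd* if all its parts are odd; $\mathcal{SP}_n$ is the set of strict partitions of $n$, and $\mathcal{SP}$, $\mathcal{OP}$ are the sets of all strict and of all odd partitions (the empty partition belongs to both). We write $|\rho|$ for the size, $\ell(\rho)$ for the length and $m_1(\rho)$ for the number of parts equal to $1$. For $\lambda\in\mathcal{SP}$ let $g^\lambda$ be the number of standard tableaux of shifted shape $\lambda$, i.e. of sequences $\emptyset=\lambda^{(0)},\lambda^{(1)},\dots,\lambda^{(|\lambda|)}=\lambda$ of strict partitions in which each shifted Young diagram $S(\lambda^{(i)})$ is obtained from $S(\lambda^{(i-1)})$ by adding exactly one box, where $S(\lambda)=\{(i,j): 1\le i\le \ell(\lambda),\ i\le j\le\lambda_i+i-1\}$. Let $\Gamma$ be the $\mathbb{Q}$-algebra generated by the odd power sums $p_1,p_3,p_5,\dots$ inside the algebra of symmetric functions with rational coefficients; its elements are called supersymmetric functions. Put $f(\lambda)=f(\lambda_1,\dots,\lambda_{\ell(\lambda)},0,0,\dots)$ and $$\mathbb{E}_n[f]=\sum_{\lambda\in\mathcal{SP}_n}\frac{2^{n-\ell(\lambda)}(g^\lambda)^2}{n!}\,f(\lambda)\qquad(n=0,1,2,\dots).$$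 With $x^{\downarrow k}=x(x-1)\cdots(x-k+1)$ and $x^{\downarrow 0}=1$, for $\lambda\in\mathcal{SP}$ with $l=\ell(\lambda)$ let $P_\lambda, P^*_\lambda\in\Gamma$ be the Schur $P$-function and the factorial Schur $P$-function, given in $N\ge l$ variables by $$\frac1{(N-l)!}\sum_{\omega\in S_N}\omega\Big(\prod_{i=1}^{l}\varphi_{\lambda_i}(x_i)\prod_{1\le i\le l,\ i<j\le N}\frac{x_i+x_j}{x_i-x_j}\Big)$$ with $\varphi_k(x)=x^k$ and $\varphi_k(x)=x^{\downarrow k}$ respectively (and by $0$ if $N<l$). Both families are linear bases of $\Gamma$; let $\Psi:\Gamma\to\Gamma$ be the linear isomorphism with $\Psi(P_\lambda)=P^*_\lambda$ for all $\lambda\in\mathcal{SP}$, and for $\rho=(\rho_1,\dots,\rho_l)\in\mathcal{OP}$ put $\mathfrak{p}_\rho=\Psi(p_{\rho_1}\cdots p_{\rho_l})$. **Proposition 4.6.** The family $(\mathfrak{p}_\rho)_{\rho\in\mathcal{OP}}$ is a linear basis of $\Gamma$. For $f\in\Gamma$ write $f=\sum_\rho a_\rho(f)\,\mathfrak{p}_\rho$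 (finite sum) and define $$\deg_1(f)=\max_{\rho:\,a_\rho(f)\ne0}\big(|\rho|+m_1(\rho)\big),\qquad \deg_1(0)=-\infty .$$ Then for every $f\in\Gamma$ $$\mathbb{E}_n[f]=\sum_{r\ge0}a_{(1^r)}(f)\,n^{\downarrow r}\qquad(n=0,1,2,\dots),$$ and $\mathbb{E}_n[f]$ is a polynomial in $n$ of degree at most $\tfrac12\deg_1(f)$ (the zero polynomial having degree $-\infty$). -/

import Mathlib

noncomputable section

namespace ShiftedPlancherel

open MvPolynomial

/-! ### Strict and odd partitions -/

/-- A strict partition: a finite strictly decreasing list of positive integers. -/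
@[ext]
structure StrictPartition where
  parts : List ℕ
  pos : ∀ i ∈ parts, 0 < i
  sorted : parts.Pairwise (fun i j => i > j)

/-- An odd partition: a finite weakly decreasing list of odd positive integers. -/
@[ext]
structure OddPartition where
  parts : List ℕ
  odd : ∀ i ∈ parts, Odd i
  sorted : parts.Pairwise (fun i j => i ≥ j)

namespace StrictPartition

/-- The length `ℓ(lam)`. -/
def length (lam : StrictPartition) : ℕ := lam.parts.length

/-- The size `|lam|`. -/
def size (lam : StrictPartition) : ℕ := lam.parts.sum

/-- The empty partition. -/
def empty : StrictPartition := ⟨[], by simp, List.Pairwise.nil⟩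

/-- The `i`-th part, `i = 0, 1, …` (zero beyond the length). -/
def part (lam : StrictPartition) (i : ℕ) : ℕ := lam.parts.getD i 0

/-- The shifted Young diagram: row `i` (counted from `0`) consists of the `lam_i` boxes
`(i, i), …, (i, i + lam_i - 1)`. -/
def diagram (lam : StrictPartition) : Set (ℕ × ℕ) :=
  {b | b.1 < lam.length ∧ b.1 ≤ b.2 ∧ b.2 < lam.part b.1 + b.1}

/-- There are finitely many strict partitions of `n`. -/
theorem finite_size_eq (n : ℕ) : {lam : StrictPartition | lam.size = n}.Finite := by
  let φ : {lam : StrictPartition | lam.size = n} → Nat.Partition n := fun lam =>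
    ⟨(lam.1.parts : Multiset ℕ), fun {i} hi => lam.1.pos i (by simpa using hi),
      by simpa [size] using lam.2⟩
  have hφ : Function.Injective φ := by
    rintro ⟨a, ha⟩ ⟨b, hb⟩ h
    have h1 : (a.parts : Multiset ℕ) = (b.parts : Multiset ℕ) := congrArg Nat.Partition.parts h
    have h2 : a.parts.Perm b.parts := Multiset.coe_eq_coe.1 h1
    have h3 : a.parts = b.parts :=
      h2.eq_of_pairwise (le := fun i j => i > j)
        (fun x y _ _ hxy hyx => absurd hxy (not_lt_of_gt hyx)) a.sorted b.sorted
    exact Subtype.ext (StrictPartition.ext h3)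
  exact Set.finite_coe_iff.1 (Finite.of_injective φ hφ)

end StrictPartition

/-- `SP_n`, the finite set of strict partitions of `n`. -/
def strictPartitionsOf (n : ℕ) : Finset StrictPartition :=
  (StrictPartition.finite_size_eq n).toFinset

namespace OddPartition

/-- The size `|rho|`. -/
def size (rho : OddPartition) : ℕ := rho.parts.sum

/-- The multiplicity `m_r(rho)` of `r` as a part of `rho`. -/
def mult (rho : OddPartition) (r : ℕ) : ℕ := rho.parts.count r

/-- The odd partition `(1^r) = (1, …, 1)` with `r` parts. -/
def ones (r : ℕ) : OddPartition where
  parts := List.replicate r 1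
  odd := fun i hi => by rw [List.eq_of_mem_replicate hi]; exact odd_one
  sorted := List.pairwise_replicate.2 (Or.inr le_rfl)

end OddPartition

/-! ### Standard tableaux and the shifted Plancherel average -/

/-- Standard tableaux of shape `S(lam/mu)`: sequences of strict partitions from `mu` to `lam`,
of length `|lam| - |mu| + 1`, in which each diagram arises from the preceding one by adding
exactly one box.  (There are none unless `S(mu) ⊆ S(lam)`.) -/
def IsStandardTableau (lam mu : StrictPartition)
    (t : Fin (lam.size - mu.size + 1) → StrictPartition) : Prop :=
  t 0 = mu ∧ t (Fin.last _) = lam ∧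
    ∀ i : Fin (lam.size - mu.size), ∃ b : ℕ × ℕ, b ∉ (t i.castSucc).diagram ∧
      (t i.succ).diagram = insert b (t i.castSucc).diagram

/-- `g^{lam/mu}`, the number of standard tableaux of shape `S(lam/mu)`. -/
def numTableauxSkew (lam mu : StrictPartition) : ℕ :=
  Nat.card {t : Fin (lam.size - mu.size + 1) → StrictPartition // IsStandardTableau lam mu t}

/-- `g^lam = g^{lam/∅}`. -/
def numTableaux (lam : StrictPartition) : ℕ := numTableauxSkew lam StrictPartition.empty

/-- The shifted Plancherel weight `2^{n - ℓ(lam)} (g^lam)^2 / n!` of a strict partition `lam`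
of `n` (note that `ℓ(lam) ≤ n`). -/
def plancherelWeight (n : ℕ) (lam : StrictPartition) : ℚ :=
  2 ^ (n - lam.length) * (numTableaux lam : ℚ) ^ 2 / (n.factorial : ℚ)

/-- The shifted Plancherel average `E_n[φ]` of a function `φ` on strict partitions. -/
def plancherelAverage (n : ℕ) (φ : StrictPartition → ℚ) : ℚ :=
  ∑ lam ∈ strictPartitionsOf n, plancherelWeight n lam * φ lam

/-! ### Symmetric and supersymmetric functions -/

/-- The substitution `F(x_1, …, x_N, x_{N+1}) ↦ F(x_1, …, x_N, 0)`. -/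
def restrict (N : ℕ) : MvPolynomial (Fin (N + 1)) ℚ →ₐ[ℚ] MvPolynomial (Fin N) ℚ :=
  aeval (Fin.snoc (α := fun _ => MvPolynomial (Fin N) ℚ) (fun i => X i) 0)

/-- The algebra of symmetric functions: families `F = (F_N)` of symmetric polynomials with
rational coefficients in `N` variables which are stable under setting the last variable to `0`.
(The member `F_0` is just the common constant term.) -/
def SymmetricFunctions : Subalgebra ℚ (∀ N : ℕ, MvPolynomial (Fin N) ℚ) where
  carrier := {F | (∀ N, (F N).IsSymmetric) ∧ ∀ N, restrict N (F (N + 1)) = F N}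
  mul_mem' := fun {F G} hF hG =>
    ⟨fun N => (hF.1 N).mul (hG.1 N), fun N => by
      rw [Pi.mul_apply, map_mul, hF.2, hG.2, Pi.mul_apply]⟩
  add_mem' := fun {F G} hF hG =>
    ⟨fun N => (hF.1 N).add (hG.1 N), fun N => by
      rw [Pi.add_apply, map_add, hF.2, hG.2, Pi.add_apply]⟩
  algebraMap_mem' := fun r =>
    ⟨fun _ => IsSymmetric.C r, fun N => by
      rw [Pi.algebraMap_apply, AlgHom.commutes, Pi.algebraMap_apply]⟩

/-- The power sum `p_r = x_1^r + x_2^r + ⋯` (only used for `r ≥ 1`). -/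
def powerSum (r : ℕ) : ∀ N : ℕ, MvPolynomial (Fin N) ℚ := fun N => psum (Fin N) ℚ r

/-- `Γ`, the algebra of supersymmetric functions, generated by `p_1, p_3, p_5, …`. -/
def Supersym : Subalgebra ℚ (∀ N : ℕ, MvPolynomial (Fin N) ℚ) :=
  Algebra.adjoin ℚ {F | ∃ r : ℕ, Odd r ∧ F = powerSum r}

/-- For `r ≥ 1` the power sum `p_r` is a symmetric function. -/
theorem powerSum_mem_symmetricFunctions {r : ℕ} (hr : 0 < r) :
    powerSum r ∈ SymmetricFunctions := by
  refine ⟨fun N => psum_isSymmetric (Fin N) ℚ r, fun N => ?_⟩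
  simp [powerSum, restrict, psum, Fin.sum_univ_castSucc, hr.ne']

/-- `Γ` is a subalgebra of the algebra of symmetric functions. -/
theorem supersym_le_symmetricFunctions : Supersym ≤ SymmetricFunctions := by
  refine Algebra.adjoin_le ?_
  rintro _ ⟨r, hr, rfl⟩
  exact powerSum_mem_symmetricFunctions hr.pos

/-- `p_rho = p_{rho_1} p_{rho_2} ⋯` for an odd partition `rho`, as an element of `Γ`. -/
def powerSumProd (rho : OddPartition) : Supersym :=
  ⟨(rho.parts.map powerSum).prod, Supersym.list_prod_mem fun _ hF => by
    obtain ⟨r, hr, rfl⟩ := List.mem_map.1 hF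
    exact Algebra.subset_adjoin ⟨r, rho.odd r hr, rfl⟩⟩

/-- The value `f(lam) = f(lam_1, …, lam_l, 0, 0, …)` of `f ∈ Γ` at a strict partition. -/
def evalAt (f : Supersym) (lam : StrictPartition) : ℚ :=
  MvPolynomial.eval (fun i : Fin lam.length => (lam.part i : ℚ)) (f.1 lam.length)

/-! ### Schur `P`-functions and factorial Schur `P`-functions -/

/-- The field of rational functions in `x_1, …, x_N`. -/
abbrev RationalFn (N : ℕ) : Type := FractionRing (MvPolynomial (Fin N) ℚ)

/-- The variable `x_i` as a rational function. -/
def ratVar {N : ℕ} (i : Fin N) : RationalFn N := algebraMap (MvPolynomial (Fin N) ℚ) _ (X i)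

/-- With `l = ℓ(lam) ≤ N` and univariate polynomials `φ_0, φ_1, …`, the rational function
`1/(N-l)! · ∑_{ω ∈ S_N} ω(φ_{lam_1}(x_1) ⋯ φ_{lam_l}(x_l) ∏_{i ≤ l, i < j ≤ N}
(x_i + x_j)/(x_i - x_j))`; it is `0` if `l > N`. -/
def symmetrization (φ : ℕ → Polynomial ℚ) (lam : StrictPartition) (N : ℕ) : RationalFn N :=
  if lam.length ≤ N then
    (((N - lam.length).factorial : ℕ) : RationalFn N)⁻¹ *
      ∑ ω : Equiv.Perm (Fin N),
        ∏ i ∈ Finset.univ.filter (fun i : Fin N => (i : ℕ) < lam.length),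
          (Polynomial.aeval (ratVar (ω i)) (φ (lam.part i)) *
            ∏ j ∈ Finset.univ.filter (fun j : Fin N => i < j),
              (ratVar (ω i) + ratVar (ω j)) / (ratVar (ω i) - ratVar (ω j)))
  else 0

open Classical in
/-- The element of `Γ` whose `N`-variable polynomial is `symmetrization φ lam N` for every `N`.
(It is unique, and it exists for the two families `φ` used below; the value `0` is only a
placeholder for other families.) -/
def symmetrizationFun (φ : ℕ → Polynomial ℚ) (lam : StrictPartition) : Supersym :=
  if h : ∃ f : Supersym, ∀ N, algebraMap (MvPolynomial (Fin N) ℚ) (RationalFn N) (f.1 N) =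
      symmetrization φ lam N
  then h.choose else 0

/-- The Schur `P`-function `P_lam`, from the powers `x^k`. -/
def schurP (lam : StrictPartition) : Supersym :=
  symmetrizationFun (fun k => Polynomial.X ^ k) lam

/-- The factorial Schur `P`-function `P*_lam`, from the descending powers
`x (x - 1) ⋯ (x - k + 1)`. -/
def factorialSchurP (lam : StrictPartition) : Supersym :=
  symmetrizationFun (fun k => descPochhammer ℚ k) lam

open Classical in
/-- The linear isomorphism `Ψ : Γ → Γ` with `Ψ(P_lam) = P*_lam` for all strict `lam`
(it exists and is unique because both families are linear bases of `Γ`). -/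
def Psi : Supersym ≃ₗ[ℚ] Supersym :=
  if h : ∃ Ψ : Supersym ≃ₗ[ℚ] Supersym, ∀ lam, Ψ (schurP lam) = factorialSchurP lam
  then h.choose else LinearEquiv.refl ℚ Supersym

/-- The supersymmetric function `𝔭_rho = Ψ(p_rho)`. -/
def frakp (rho : OddPartition) : Supersym := Psi (powerSumProd rho)

/-- `deg_1` of the linear combination `∑ a_rho 𝔭_rho`: the maximum of `|rho| + m_1(rho)` over
all `rho` with `a_rho ≠ 0` (and `⊥ = -∞` if there is none). -/
def degOne (a : OddPartition →₀ ℚ) : WithBot ℕ :=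
  a.support.sup fun rho => ((rho.size + rho.mult 1 : ℕ) : WithBot ℕ)

end ShiftedPlancherel

end

/-! The average of a function `𝔭_rho` is computed by passing from factorial to ordinary Schur
`P`-functions. Everything rests on one identity: for every strict `mu` the average of `P*_mu` is
`n^{↓|mu|} · expSpec (P_mu)`, where `expSpec` is the specialization `p_1 ↦ 1`, `p_3, p_5, … ↦ 0`
(`averageHom_factorialSchurP`). By linearity the average of `Ψ(f)` is `n^{↓k} · expSpec f` for `f`
homogeneous of degree `k`. For `f = p_rho` this is `n^{↓r}` if `rho = (1^r)` and `0` otherwise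
(`averageHom_frakp`). The degree bound follows, since `(1^r)` counts `r + r` in `deg_1` while
`n^{↓r}` has degree `r`.

The identity comes from two evaluations. Multiplication by `p_1` adds a box, with an extra term
`|mu| P*_mu` in the factorial case. Evaluated at `lam`, and combined with the vanishing of
`P*_mu(lam)` when `|lam| ≤ |mu|` and `lam ≠ mu`, this yields `P*_mu(lam) = n^{↓|mu|} g^{lam/mu} /
g^lam` for `n = |lam| ≥ |mu|` (`factorial_mul_evalHom`, `numTableaux_mul_evalHom`). Dually,
differentiating by `p_1` removes a box, with weight `2` or `1` according to whether the length stays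
or drops, and this gives `n! · expSpec (P_lam) = 2^{n-ℓ(lam)} g^lam`
(`factorial_mul_expSpec_schurP`). The derivative is realized by adjoining a variable `ε` with `ε² =
0`. In the average one factor `g^lam` cancels, and `∑ g^{lam/mu} P_lam = p_1^{n-|mu|} P_mu` finishes
the computation because `expSpec` ignores factors `p_1`.

That both families lie in `Γ` and are bases is also proved here. The symmetrizations are iterated
creation operators (`create`), which anticommute and with respect to which power sums act as
derivations. Since an odd power sum is itself a combination of symmetrizations
(`setPsum_eq_create`), all `p_rho` lie in their span, with control of the degree. The `p_rho` are
independent, and by Euler's theorem there are as many odd as strict partitions of each size, so a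
dimension count reverses the inclusion (`IsGraded.count`). -/

noncomputable section

namespace ShiftedPlancherel

open MvPolynomial

/-! ### Creation operators -/

section Operators

set_option linter.unusedSectionVars false

variable {ι A : Type*} [DecidableEq ι] [CommRing A] [Algebra ℚ A]

/-- The factor `(x_i + x_j) / (x_i - x_j)`. -/
def crossFactor (x : ι → A) (i j : ι) : A := (x i + x j) * Ring.inverse (x i - x j)

/-- The product of the factors `(x_i + x_j) / (x_i - x_j)` over `j ∈ S`. -/
def crossProd (x : ι → A) (i : ι) (S : Finset ι) : A := ∏ j ∈ S, crossFactor x i j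

/-- The creation operator
`F ↦ (S ↦ ∑_{i ∈ S} g(x_i) ∏_{j ∈ S \ i} (x_i + x_j) / (x_i - x_j) F(S \ i))`. -/
def create (x : ι → A) (g : Polynomial ℚ) (F : Finset ι → A) (S : Finset ι) : A :=
  ∑ i ∈ S, Polynomial.aeval (x i) g * crossProd x i (S.erase i) * F (S.erase i)

/-- The iterated creation operators applied to the constant function `1`. -/
def createList (x : ι → A) (fs : List (Polynomial ℚ)) : Finset ι → A :=
  fs.foldr (create x) 1

@[simp] theorem createList_nil (x : ι → A) : createList x [] = 1 := rfl

@[simp] theorem createList_cons (x : ι → A) (f : Polynomial ℚ) (fs : List (Polynomial ℚ)) :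
    createList x (f :: fs) = create x f (createList x fs) := rfl

/-- No invertibility is needed: `Ring.inverse` is odd also at non-units, where it takes the value
`0`. -/
theorem crossFactor_swap (x : ι → A) (i j : ι) : crossFactor x j i = -crossFactor x i j := by
  have h : Ring.inverse (x j - x i) = -Ring.inverse (x i - x j) := by
    by_cases hu : IsUnit (x i - x j)
    · have hu' : IsUnit (x j - x i) := by rw [← neg_sub]; exact hu.neg
      refine hu'.mul_left_cancel ?_
      rw [Ring.mul_inverse_cancel _ hu', ← neg_sub (x i), neg_mul_neg,
        Ring.mul_inverse_cancel _ hu]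
    · have hu' : ¬ IsUnit (x j - x i) := by rw [← neg_sub, IsUnit.neg_iff]; exact hu
      rw [Ring.inverse_non_unit _ hu, Ring.inverse_non_unit _ hu', neg_zero]
  rw [crossFactor, crossFactor, h]; ring

theorem crossProd_erase (x : ι → A) (i : ι) {j : ι} {S : Finset ι} (hj : j ∈ S) :
    crossProd x i S = crossFactor x i j * crossProd x i (S.erase j) :=
  (Finset.mul_prod_erase S _ hj).symm

theorem create_add (x : ι → A) (g h : Polynomial ℚ) (F : Finset ι → A) :
    create x (g + h) F = create x g F + create x h F := by
  funext S; simp [create, add_mul, Finset.sum_add_distrib]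

theorem create_smul (x : ι → A) (a : ℚ) (g : Polynomial ℚ) (F : Finset ι → A) :
    create x (a • g) F = a • create x g F := by
  funext S; simp [create, Finset.smul_sum]

theorem create_zero (x : ι → A) (F : Finset ι → A) : create x 0 F = 0 := by
  funext S; simp [create]

theorem create_apply_add (x : ι → A) (g : Polynomial ℚ) (F G : Finset ι → A) :
    create x g (F + G) = create x g F + create x g G := by
  funext S; simp [create, mul_add, Finset.sum_add_distrib]

theorem create_apply_smul (x : ι → A) (g : Polynomial ℚ) (a : ℚ) (F : Finset ι → A) :
    create x g (a • F) = a • create x g F := by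
  funext S; simp [create, Finset.smul_sum]

theorem create_apply_zero (x : ι → A) (g : Polynomial ℚ) : create x g 0 = 0 := by
  funext S; simp [create]

theorem create_create (x : ι → A) (g h : Polynomial ℚ) (F : Finset ι → A) (S : Finset ι) :
    create x g (create x h F) S = ∑ i ∈ S, ∑ j ∈ S.erase i,
      Polynomial.aeval (x i) g * Polynomial.aeval (x j) h * crossFactor x i j *
        (crossProd x i ((S.erase i).erase j) * crossProd x j ((S.erase i).erase j)) *
          F ((S.erase i).erase j) := by
  refine Finset.sum_congr rfl fun i _ => ?_
  rw [create, Finset.mul_sum]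
  refine Finset.sum_congr rfl fun j hj => ?_
  rw [crossProd_erase x i hj]; ring

theorem sum_erase_comm {M : Type*} [AddCommMonoid M] (S : Finset ι) (f : ι → ι → M) :
    ∑ i ∈ S, ∑ j ∈ S.erase i, f i j = ∑ j ∈ S, ∑ i ∈ S.erase j, f i j := by
  refine Finset.sum_comm' fun i j => ?_
  simp only [Finset.mem_erase, ne_eq]
  constructor
  · rintro ⟨hi, hji, hj⟩; exact ⟨⟨fun h => hji h.symm, hi⟩, hj⟩
  · rintro ⟨⟨hij, hi⟩, hj⟩; exact ⟨hi, fun h => hij h.symm, hj⟩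

/-- In the double sum for two creations the only factor that is not symmetric in the two chosen
indices is `crossFactor x i j`, and it changes sign under their exchange. -/
theorem create_comm (x : ι → A) (g h : Polynomial ℚ) (F : Finset ι → A) :
    create x g (create x h F) = -create x h (create x g F) := by
  funext S
  rw [Pi.neg_apply, create_create, create_create, sum_erase_comm, ← Finset.sum_neg_distrib]
  refine Finset.sum_congr rfl fun i _ => ?_
  rw [← Finset.sum_neg_distrib]
  refine Finset.sum_congr rfl fun j _ => ?_
  rw [crossFactor_swap x i j, Finset.erase_right_comm]; ring

theorem create_self (x : ι → A) (g : Polynomial ℚ) (F : Finset ι → A) :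
    create x g (create x g F) = 0 := by
  have h := create_comm x g g F
  have h2 : (2 : ℚ) • create x g (create x g F) = 0 := by
    rw [two_smul]; nth_rewrite 1 [h]; exact neg_add_cancel _
  exact (smul_eq_zero.1 h2).resolve_left two_ne_zero

/-- A weakly decreasing list that is not strict has two equal neighbours, and the square of a
creation operator is zero. -/
theorem createList_eq_zero_of_not_strict {ι A : Type*} [DecidableEq ι] [CommRing A] [Algebra ℚ A]
    (x : ι → A) (φ : ℕ → Polynomial ℚ) {l : List ℕ} (h : l.Pairwise (· ≥ ·))
    (h' : ¬ l.Pairwise (· > ·)) : createList x (l.map φ) = 0 := by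
  induction l with
  | nil => simp at h'
  | cons k l ih =>
    rw [List.map_cons, createList_cons]
    rw [List.pairwise_cons] at h h'
    by_cases hl : l.Pairwise (· > ·)
    · obtain _ | ⟨m, l⟩ := l
      · simp at h'
      have hkm : k = m := by
        by_contra hne
        refine h' ⟨fun a ha => ?_, hl⟩
        have hk := h.1 m List.mem_cons_self
        rcases List.mem_cons.1 ha with rfl | ha
        · exact lt_of_le_of_ne hk (Ne.symm hne)
        · exact ((List.pairwise_cons.1 hl).1 a ha).trans_le hk
      rw [hkm, List.map_cons, createList_cons, create_self]
    · rw [ih h.2 hl, create_apply_zero]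

theorem createList_eq_zero_of_card_lt (x : ι → A) (fs : List (Polynomial ℚ)) :
    ∀ S : Finset ι, S.card < fs.length → createList x fs S = 0 := by
  induction fs with
  | nil => intro S h; simp at h
  | cons f fs ih =>
    intro S h
    rw [createList_cons, create]
    refine Finset.sum_eq_zero fun i hi => ?_
    rw [ih, mul_zero]
    rw [Finset.card_erase_of_mem hi]
    have := Finset.card_pos.2 ⟨i, hi⟩
    simp only [List.length_cons] at h
    omega

/-- Compatibility of the creation operators with ring homomorphisms and reindexing. -/
theorem map_createList {κ B : Type*} [DecidableEq κ] [CommRing B] [Algebra ℚ B] (θ : A →ₐ[ℚ] B)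
    (x : ι → A) (y : κ → B) (e : ι ↪ κ) (hy : ∀ i, y (e i) = θ (x i))
    (hx : ∀ i j, i ≠ j → IsUnit (x i - x j)) (fs : List (Polynomial ℚ)) :
    ∀ S : Finset ι, θ (createList x fs S) = createList y fs (S.map e) := by
  -- A homomorphism is only guaranteed to respect `Ring.inverse` at units, which is why the
  -- differences are assumed invertible.
  have hc : ∀ i j, i ≠ j → θ (crossFactor x i j) = crossFactor y (e i) (e j) := by
    intro i j hij
    have hu := hx i j hij
    have hu' : IsUnit (y (e i) - y (e j)) := by rw [hy, hy, ← map_sub]; exact hu.map θ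
    rw [crossFactor, crossFactor, map_mul, map_add, hy, hy]
    congr 1
    rw [hy, hy] at hu'
    refine hu'.mul_left_cancel ?_
    rw [Ring.mul_inverse_cancel _ hu', ← map_sub, ← map_mul, Ring.mul_inverse_cancel _ hu, map_one]
  induction fs with
  | nil => intro S; simp
  | cons f fs ih =>
    intro S
    rw [createList_cons, createList_cons, create, create, map_sum, Finset.sum_map]
    refine Finset.sum_congr rfl fun i _ => ?_
    rw [map_mul, map_mul, ih, ← Finset.map_erase, crossProd, crossProd, map_prod, Finset.prod_map,
      hy, Polynomial.aeval_algHom_apply]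
    congr 2
    refine Finset.prod_congr rfl fun j hj => hc i j ?_
    exact (Finset.ne_of_mem_erase hj).symm

/-- The power sum `∑_{i ∈ S} x_i^r`. -/
def setPsum (x : ι → A) (r : ℕ) (S : Finset ι) : A := ∑ i ∈ S, x i ^ r

/-- The power sum over `S` is the one over `S \ i` plus `x_i^r`. So multiplication by `p_r` moves
past a creation operator like a derivation. -/
theorem setPsum_mul_create (x : ι → A) (r : ℕ) (g : Polynomial ℚ) (F : Finset ι → A) :
    setPsum x r * create x g F =
      create x (Polynomial.X ^ r * g) F + create x g (setPsum x r * F) := by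
  funext S
  simp only [Pi.mul_apply, Pi.add_apply, create, ← Finset.sum_add_distrib, Finset.mul_sum]
  refine Finset.sum_congr rfl fun i hi => ?_
  have : setPsum x r S = x i ^ r + setPsum x r (S.erase i) :=
    (Finset.add_sum_erase S _ hi).symm
  rw [this]; simp only [map_mul, map_pow, Polynomial.aeval_X]; ring

end Operators

/-! ### Partial fractions and the odd power sums -/

section Field

set_option linter.unusedSectionVars false

variable {ι K : Type*} [DecidableEq ι] [Field K]

theorem crossFactor_eq_div (x : ι → K) (i j : ι) :
    crossFactor x i j = (x i + x j) / (x i - x j) := by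
  rw [crossFactor, Ring.inverse_eq_inv', div_eq_mul_inv]

/-- Partial fraction expansion of `∏_{i ∈ S} (z + x_i) / (z - x_i)`. -/
theorem prod_add_div_sub (S : Finset ι) (x : ι → K) (hx : Set.InjOn x S) (z : K)
    (hz : ∀ i ∈ S, z ≠ x i) :
    ∏ i ∈ S, (z + x i) / (z - x i) =
      1 + ∑ i ∈ S, 2 * x i / (z - x i) * crossProd x i (S.erase i) := by
  classical
  -- Both products are monic, so their difference has degree below `|S|` and equals its Lagrange
  -- interpolant at the `x_i`. At `x_i` the second product vanishes and the first one contributes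
  -- the residue `2 x_i ∏ (x_i + x_j)`.
  set P : Polynomial K := ∏ i ∈ S, (Polynomial.X + Polynomial.C (x i)) -
    ∏ i ∈ S, (Polynomial.X - Polynomial.C (x i)) with hP
  have hdeg : P.degree < S.card := by
    have h1 : (∏ i ∈ S, (Polynomial.X + Polynomial.C (x i))).Monic :=
      Polynomial.monic_prod_of_monic _ _ fun i _ => Polynomial.monic_X_add_C _
    have h2 : (∏ i ∈ S, (Polynomial.X - Polynomial.C (x i))).Monic :=
      Polynomial.monic_prod_of_monic _ _ fun i _ => Polynomial.monic_X_sub_C _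
    have d1 : (∏ i ∈ S, (Polynomial.X + Polynomial.C (x i))).degree = (S.card : WithBot ℕ) := by
      rw [Polynomial.degree_prod]; simp
    have d2 : (∏ i ∈ S, (Polynomial.X - Polynomial.C (x i))).degree = (S.card : WithBot ℕ) := by
      rw [Polynomial.degree_prod]; simp
    rw [← d1]
    exact Polynomial.degree_sub_lt_left (by rw [d1, d2]) h1.ne_zero
      (by rw [h1.leadingCoeff, h2.leadingCoeff])
  have hev := Lagrange.eval_interpolate_not_at_node (r := fun i => P.eval (x i)) (s := S) (v := x)
    (x := z) hz
  rw [← Lagrange.eq_interpolate hx hdeg] at hev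
  have hne : ∏ i ∈ S, (z - x i) ≠ 0 :=
    Finset.prod_ne_zero_iff.2 fun i hi => sub_ne_zero.2 (hz i hi)
  have hPz : P.eval z = ∏ i ∈ S, (z + x i) - ∏ i ∈ S, (z - x i) := by
    simp [hP, Polynomial.eval_prod]
  rw [hPz, Lagrange.eval_nodal] at hev
  rw [Finset.prod_div_distrib, div_eq_iff hne, add_mul, one_mul, ← sub_eq_iff_eq_add', hev, mul_comm]
  congr 1
  refine Finset.sum_congr rfl fun i hi => ?_
  have hPi : P.eval (x i) = 2 * x i * ∏ j ∈ S.erase i, (x i + x j) := by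
    simp only [hP, Polynomial.eval_sub, Polynomial.eval_prod, Polynomial.eval_add,
      Polynomial.eval_X, Polynomial.eval_C]
    rw [Finset.prod_eq_zero (f := fun j => x i - x j) hi (sub_self (x i)), sub_zero, ← Finset.mul_prod_erase S _ hi]
    ring
  rw [hPi, Lagrange.nodalWeight, crossProd, Finset.prod_congr rfl
    (fun j _ => (crossFactor_eq_div x i j).trans (div_eq_mul_inv _ _)), Finset.prod_mul_distrib,
    div_eq_mul_inv]
  ring

end Field

theorem telescoping_aux {A : Type*} [CommRing A] (a b : A) (m : ℕ) :
    (a + b) * ∑ k ∈ Finset.range m, (-1) ^ (k + 1) * (a ^ (m - k) * b ^ (k + 1)) =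
      a * b * ((-1) ^ m * b ^ m - a ^ m) := by
  induction m with
  | zero => simp
  | succ m ih =>
    rw [Finset.sum_range_succ, mul_add]
    have : ∑ k ∈ Finset.range m, (-1) ^ (k + 1) * (a ^ (m + 1 - k) * b ^ (k + 1)) =
        a * ∑ k ∈ Finset.range m, (-1) ^ (k + 1) * (a ^ (m - k) * b ^ (k + 1)) := by
      rw [Finset.mul_sum]
      refine Finset.sum_congr rfl fun k hk => ?_
      rw [Nat.succ_sub (Finset.mem_range.1 hk).le, pow_succ a]; ring
    rw [this, mul_left_comm, ih, Nat.add_sub_cancel_left]; ring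

/-- The odd power sums in terms of the creation operators. -/
theorem setPsum_eq_create {ι K : Type*} [DecidableEq ι] [Field K] [Algebra ℚ K] (x : ι → K)
    (hx : Function.Injective x) (hx' : ∀ i j, x i + x j ≠ 0) {r : ℕ} (hr : Odd r) :
    setPsum x r = createList x [Polynomial.X ^ r] + ∑ k ∈ Finset.range (r - 1),
      (-1 : ℚ) ^ (k + 1) •
        createList x [Polynomial.X ^ (r - 1 - k), Polynomial.X ^ (k + 1)] := by
  funext S
  -- Oddness of `r` enters here: with `r - 1` even, the alternating sum over `k` telescopes to a
  -- kernel which, apart from the cross factor, is antisymmetric in `i, j`. The whole summand is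
  -- then symmetric, and the double sum collapses to twice one half.
  have hr1 : Even (r - 1) := hr.tsub_odd odd_one
  have hw : ∀ i ∈ S, crossProd x i (S.erase i) ≠ 0 := by
    intro i _
    refine Finset.prod_ne_zero_iff.2 fun j hj => ?_
    rw [crossFactor_eq_div]
    exact div_ne_zero (hx' i j) (sub_ne_zero.2 (hx.ne (Finset.ne_of_mem_erase hj).symm))
  -- the double sum after telescoping
  have h1 : (∑ k ∈ Finset.range (r - 1), (-1 : ℚ) ^ (k + 1) •
      createList x [Polynomial.X ^ (r - 1 - k), Polynomial.X ^ (k + 1)]) S =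
      ∑ i ∈ S, ∑ j ∈ S.erase i, x i * x j * (x j ^ (r - 1) - x i ^ (r - 1)) / (x i + x j) *
        crossFactor x i j *
        (crossProd x i ((S.erase i).erase j) * crossProd x j ((S.erase i).erase j)) := by
    simp only [Finset.sum_apply, Pi.smul_apply, createList_cons, createList_nil, create_create]
    simp only [Algebra.smul_def, Finset.mul_sum]
    rw [Finset.sum_comm]
    refine Finset.sum_congr rfl fun i _ => ?_
    rw [Finset.sum_comm]
    refine Finset.sum_congr rfl fun j _ => ?_
    have ht := telescoping_aux (x i) (x j) (r - 1)
    rw [hr1.neg_one_pow, one_mul] at ht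
    rw [← ht, mul_div_cancel_left₀ _ (hx' i j), Finset.sum_mul, Finset.sum_mul]
    refine Finset.sum_congr rfl fun k _ => ?_
    simp only [map_pow, map_neg, map_one, Polynomial.aeval_X, Pi.one_apply]
    ring
  -- symmetrize
  have h2 : ∑ i ∈ S, ∑ j ∈ S.erase i, x i * x j * (x j ^ (r - 1) - x i ^ (r - 1)) / (x i + x j) *
        crossFactor x i j *
        (crossProd x i ((S.erase i).erase j) * crossProd x j ((S.erase i).erase j)) =
      ∑ i ∈ S, ∑ j ∈ S.erase i, -2 * (x i ^ r * x j / (x i + x j) *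
        crossFactor x i j *
        (crossProd x i ((S.erase i).erase j) * crossProd x j ((S.erase i).erase j))) := by
    have e : ∀ i j, x i * x j * (x j ^ (r - 1) - x i ^ (r - 1)) / (x i + x j) *
        crossFactor x i j *
        (crossProd x i ((S.erase i).erase j) * crossProd x j ((S.erase i).erase j)) =
        -(x j ^ r * x i / (x j + x i) *
        crossFactor x j i *
        (crossProd x j ((S.erase j).erase i) * crossProd x i ((S.erase j).erase i))) -
        (x i ^ r * x j / (x i + x j) *
        crossFactor x i j *
        (crossProd x i ((S.erase i).erase j) * crossProd x j ((S.erase i).erase j))) := by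
      intro i j
      obtain ⟨m, rfl⟩ : ∃ m, r = m + 1 := ⟨r - 1, (Nat.sub_add_cancel hr.pos).symm⟩
      rw [crossFactor_swap x i j, Finset.erase_right_comm (a := j), add_comm (x j) (x i),
        Nat.add_sub_cancel]
      ring
    simp only [e, Finset.sum_sub_distrib, Finset.sum_neg_distrib]
    rw [← sum_erase_comm S (fun i j => x i ^ r * x j / (x i + x j) *
        crossFactor x i j *
        (crossProd x i ((S.erase i).erase j) * crossProd x j ((S.erase i).erase j)))]
    simp only [← Finset.mul_sum]
    ring
  rw [Pi.add_apply, h1, h2, createList_cons, createList_nil, create, ← Finset.sum_add_distrib]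
  refine Finset.sum_congr rfl fun i hi => ?_
  -- At `z = -x_i` the partial fraction product over `S \ i` is the reciprocal of `crossProd x i
  -- (S.erase i)`. Hence the inner sum over `j` becomes `x_i^r` minus exactly the term supplied by
  -- the single creation operator.
  have hp := prod_add_div_sub (S.erase i) x hx.injOn (-x i) fun j _ h =>
    hx' i j (by rw [← h, add_neg_cancel])
  have hinv : ∏ j ∈ S.erase i, (-x i + x j) / (-x i - x j) = (crossProd x i (S.erase i))⁻¹ := by
    rw [crossProd, ← Finset.prod_inv_distrib]
    refine Finset.prod_congr rfl fun j _ => ?_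
    rw [crossFactor_eq_div, inv_div, ← neg_add', ← sub_eq_neg_add, ← neg_sub, neg_div_neg_eq]
  rw [hinv] at hp
  have hs : ∑ j ∈ S.erase i, -2 * (x i ^ r * x j / (x i + x j) * crossFactor x i j *
      (crossProd x i ((S.erase i).erase j) * crossProd x j ((S.erase i).erase j))) =
      x i ^ r * crossProd x i (S.erase i) * ∑ j ∈ S.erase i, 2 * x j / (-x i - x j) *
        crossProd x j ((S.erase i).erase j) := by
    rw [Finset.mul_sum]
    refine Finset.sum_congr rfl fun j hj => ?_
    rw [crossProd_erase x i hj, ← neg_add', div_neg]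
    ring
  rw [hs, ← sub_eq_iff_eq_add'.2 hp, mul_sub, mul_assoc (x i ^ r), mul_inv_cancel₀ (hw i hi)]
  simp

/-! ### Symmetrizations as iterated creation operators -/

theorem sum_perm_succ {M : Type*} [AddCommMonoid M] (N : ℕ) (f : (Fin (N + 1) → Fin (N + 1)) → M) :
    ∑ ω : Equiv.Perm (Fin (N + 1)), f ω =
      ∑ p : Fin (N + 1), ∑ σ : Equiv.Perm (Fin N), f (Fin.cons p fun i => Equiv.swap 0 p (σ i).succ) := by
  rw [← Fintype.sum_prod_type', ← Equiv.sum_comp Equiv.Perm.decomposeFin.symm]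
  refine Finset.sum_congr rfl fun pσ _ => ?_
  congr 1
  funext i
  refine Fin.cases ?_ (fun j => ?_) i
  · simp [Equiv.Perm.decomposeFin_symm_apply_zero pσ.1 pσ.2]
  · simp [Equiv.Perm.decomposeFin_symm_apply_succ pσ.2 pσ.1]

theorem prod_filter_lt_succ {M : Type*} [CommMonoid M] (N : ℕ) (i : Fin N) (f : Fin (N + 1) → M) :
    ∏ j ∈ Finset.univ.filter (fun j : Fin (N + 1) => i.succ < j), f j =
      ∏ j ∈ Finset.univ.filter (fun j : Fin N => i < j), f j.succ := by
  rw [Finset.prod_filter, Fin.prod_univ_succ, Finset.prod_filter]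
  simp [Fin.succ_lt_succ_iff]

/-- The value `p = ω(0)` is the index chosen by the outermost creation operator, and the rest of `ω`
permutes the complement of `p`. When the list is exhausted, the remaining positions are free and
account for the factorial. -/
theorem sum_perm_eq_createList {A : Type*} [CommRing A] [Algebra ℚ A]
    (fs : List (Polynomial ℚ)) : ∀ (N : ℕ) (x : Fin N → A), Function.Injective x →
    (∀ i j, i ≠ j → IsUnit (x i - x j)) → fs.length ≤ N →
    ∑ ω : Equiv.Perm (Fin N),
        ∏ i ∈ Finset.univ.filter (fun i : Fin N => (i : ℕ) < fs.length),
          (Polynomial.aeval (x (ω i)) (fs.getD i 0) *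
            ∏ j ∈ Finset.univ.filter (fun j : Fin N => i < j), crossFactor x (ω i) (ω j)) =
      ((N - fs.length).factorial : A) * createList x fs Finset.univ := by
  induction fs with
  | nil =>
    intro N x _ _ _
    simp [Fintype.card_perm]
  | cons f fs ih =>
    intro N x hx hu hl
    obtain _ | N := N
    · simp at hl
    simp only [List.length_cons, Nat.add_le_add_iff_right] at hl
    rw [sum_perm_succ N (fun ω => ∏ i ∈ Finset.univ.filter
        (fun i : Fin (N + 1) => (i : ℕ) < (f :: fs).length),
          (Polynomial.aeval (x (ω i)) ((f :: fs).getD i 0) *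
            ∏ j ∈ Finset.univ.filter (fun j : Fin (N + 1) => i < j), crossFactor x (ω i) (ω j)))]
    rw [createList_cons, create, Finset.mul_sum]
    refine Finset.sum_congr rfl fun p _ => ?_
    -- This enumerates the complement of `p`; the residual permutation `σ` only reorders the
    -- enumeration.
    set e : Fin N ↪ Fin (N + 1) :=
      ⟨fun i => Equiv.swap 0 p i.succ, fun i j h => Fin.succ_injective _ ((Equiv.injective _) h)⟩
      with he
    have hmap : (Finset.univ : Finset (Fin N)).map e = Finset.univ.erase p := by
      refine Finset.eq_of_subset_of_card_le ?_ ?_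
      · intro k hk
        obtain ⟨i, -, rfl⟩ := Finset.mem_map.1 hk
        refine Finset.mem_erase.2 ⟨fun h => ?_, Finset.mem_univ _⟩
        have : Equiv.swap 0 p i.succ = Equiv.swap 0 p 0 := by
          rw [Equiv.swap_apply_left]; exact h
        exact Fin.succ_ne_zero i ((Equiv.injective _) this)
      · simp
    have key := ih N (fun i => x (e i)) (hx.comp e.injective)
      (fun i j h => hu _ _ (e.injective.ne h)) hl
    have hm := map_createList (AlgHom.id ℚ A) (fun i => x (e i)) x e (fun i => rfl)
      (fun i j h => hu _ _ (e.injective.ne h)) fs Finset.univ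
    rw [AlgHom.id_apply, hmap] at hm
    rw [hm] at key
    rw [List.length_cons, Nat.add_sub_add_right, mul_left_comm, ← key, Finset.mul_sum]
    refine Finset.sum_congr rfl fun σ _ => ?_
    rw [Finset.prod_filter, Fin.prod_univ_succ, Finset.prod_filter]
    refine congrArg₂ (· * ·) ?_ ?_
    · rw [if_pos (by simp), Fin.cons_zero]
      congr 1
      rw [← hmap, crossProd, Finset.prod_map, Fin.prod_univ_succ]
      simp only [lt_self_iff_false, if_false, Fin.succ_pos, if_true, one_mul, Fin.cons_succ]
      exact Equiv.prod_comp σ (fun i => crossFactor x p (e i))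
    · rw [Finset.prod_filter]
      refine Finset.prod_congr rfl fun i _ => ?_
      rw [prod_filter_lt_succ]
      simp only [Fin.val_succ, Nat.add_lt_add_iff_right, Fin.cons_succ, List.getD_cons_succ]
      rfl

theorem ratVar_injective (N : ℕ) : Function.Injective (ratVar : Fin N → RationalFn N) :=
  (IsFractionRing.injective (MvPolynomial (Fin N) ℚ) (RationalFn N)).comp (X_injective)

theorem ratVar_sub_isUnit {N : ℕ} {i j : Fin N} (h : i ≠ j) :
    IsUnit (ratVar i - ratVar j : RationalFn N) :=
  (sub_ne_zero.2 ((ratVar_injective N).ne h)).isUnit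

theorem symmetrization_eq_createList (φ : ℕ → Polynomial ℚ) (lam : StrictPartition) (N : ℕ) :
    symmetrization φ lam N = createList ratVar (lam.parts.map φ) Finset.univ := by
  rw [symmetrization]
  split_ifs with h
  · have h2 := sum_perm_eq_createList (lam.parts.map φ) N (ratVar : Fin N → RationalFn N)
      (ratVar_injective N) (fun i j hij => ratVar_sub_isUnit hij)
      (by rw [List.length_map]; exact h)
    have hl : (lam.parts.map φ).length = lam.length := by simp [StrictPartition.length]
    rw [hl] at h2
    have h0 : (((N - lam.length).factorial : ℕ) : RationalFn N) ≠ 0 :=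
      Nat.cast_ne_zero.2 (Nat.factorial_ne_zero _)
    rw [inv_mul_eq_iff_eq_mul₀ h0, ← h2]
    refine Finset.sum_congr rfl fun ω _ => Finset.prod_congr rfl fun i hi => ?_
    have hi' : (i : ℕ) < lam.parts.length := (Finset.mem_filter.1 hi).2
    congr 1
    · rw [StrictPartition.part, List.getD_eq_getElem _ _ hi',
        List.getD_eq_getElem _ _ (by simpa using hi'), List.getElem_map]
    · exact Finset.prod_congr rfl fun j _ => (crossFactor_eq_div _ _ _).symm
  · rw [createList_eq_zero_of_card_lt]
    rw [List.length_map, Finset.card_univ, Fintype.card_fin]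
    exact not_le.1 (fun h' => h h')

/-! ### Power sums in the span of symmetrizations -/

section Families

/-- Families, indexed by the number `N` of variables, of functions of a set of variables. -/
abbrev VarFamily (K : ℕ → Type*) : Type _ := ∀ N : ℕ, Finset (Fin N) → K N

variable {K : ℕ → Type*} [∀ N, Field (K N)] [∀ N, CharZero (K N)] (x : ∀ N, Fin N → K N)

/-- The creation operator on families. -/
def createFamily (g : Polynomial ℚ) (F : VarFamily K) : VarFamily K :=
  fun N => create (x N) g (F N)

/-- The family of symmetrizations for a list of exponents. -/
def symmFamily (φ : ℕ → Polynomial ℚ) (l : List ℕ) : VarFamily K :=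
  fun N => createList (x N) (l.map φ)

/-- The power sums as a family. -/
def psumFamily (r : ℕ) : VarFamily K := fun N => setPsum (x N) r

/-- The span of the symmetrizations of all lists of positive exponents whose sum is related
to `n`. -/
def symmSpan (φ : ℕ → Polynomial ℚ) (R : ℕ → ℕ → Prop) (n : ℕ) : Submodule ℚ (VarFamily K) :=
  Submodule.span ℚ {F | ∃ l : List ℕ, (∀ i ∈ l, 0 < i) ∧ R l.sum n ∧ F = symmFamily x φ l}

/-- The relations on degrees (equality, or less or equal) with respect to which a family of
polynomials is compatible with multiplication by the variable. -/
structure IsGraded (φ : ℕ → Polynomial ℚ) (R : ℕ → ℕ → Prop) : Prop where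
  refl : ∀ n, R n n
  trans : ∀ {a b c}, R a b → R b c → R a c
  add : ∀ {a b c d}, R a b → R c d → R (a + c) (b + d)
  one : φ 1 = Polynomial.X
  mul_X : ∀ k, 0 < k → Polynomial.X * φ k ∈
    Submodule.span ℚ (φ '' {m | 0 < m ∧ R m (k + 1)})

variable {φ : ℕ → Polynomial ℚ} {R : ℕ → ℕ → Prop}

theorem symmFamily_mem {l : List ℕ} {n : ℕ} (hl : ∀ i ∈ l, 0 < i) (h : R l.sum n) :
    symmFamily x φ l ∈ symmSpan x φ R n := Submodule.subset_span ⟨l, hl, h, rfl⟩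

theorem createFamily_add (g h : Polynomial ℚ) (F : VarFamily K) :
    createFamily x (g + h) F = createFamily x g F + createFamily x h F :=
  _root_.funext fun _ => create_add _ _ _ _

theorem createFamily_smul (a : ℚ) (g : Polynomial ℚ) (F : VarFamily K) :
    createFamily x (a • g) F = a • createFamily x g F := _root_.funext fun _ => create_smul _ _ _ _

theorem createFamily_apply_add (g : Polynomial ℚ) (F G : VarFamily K) :
    createFamily x g (F + G) = createFamily x g F + createFamily x g G :=
  _root_.funext fun _ => create_apply_add _ _ _ _

theorem createFamily_apply_smul (a : ℚ) (g : Polynomial ℚ) (F : VarFamily K) :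
    createFamily x g (a • F) = a • createFamily x g F := _root_.funext fun _ => create_apply_smul _ _ _ _

theorem IsGraded.createFamily_mem (hφ : IsGraded φ R) {g : Polynomial ℚ} {F : VarFamily K}
    {k n : ℕ} (hg : g ∈ Submodule.span ℚ (φ '' {m | 0 < m ∧ R m k}))
    (hF : F ∈ symmSpan x φ R n) : createFamily x g F ∈ symmSpan x φ R (k + n) := by
  induction hg using Submodule.span_induction with
  | mem g hg =>
    obtain ⟨m, ⟨hm, hmk⟩, rfl⟩ := hg
    induction hF using Submodule.span_induction with
    | mem F hF =>
      obtain ⟨l, hl, hln, rfl⟩ := hF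
      refine Submodule.subset_span ⟨m :: l, ?_, ?_, rfl⟩
      · simpa using ⟨hm, hl⟩
      · rw [List.sum_cons]; exact hφ.add hmk hln
    | zero =>
      have : createFamily x (φ m) 0 = 0 := _root_.funext fun _ => create_apply_zero _ _
      rw [this]; exact zero_mem _
    | add F G _ _ h1 h2 => rw [createFamily_apply_add]; exact add_mem h1 h2
    | smul a F _ h => rw [createFamily_apply_smul]; exact Submodule.smul_mem _ _ h
  | zero =>
    have : createFamily x 0 F = 0 := _root_.funext fun _ => create_zero _ _
    rw [this]; exact zero_mem _
  | add g h _ _ h1 h2 => rw [createFamily_add]; exact add_mem h1 h2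
  | smul a g _ h => rw [createFamily_smul]; exact Submodule.smul_mem _ _ h

theorem IsGraded.X_mul_mem (hφ : IsGraded φ R) {g : Polynomial ℚ} {k : ℕ}
    (hg : g ∈ Submodule.span ℚ (φ '' {m | 0 < m ∧ R m k})) :
    Polynomial.X * g ∈ Submodule.span ℚ (φ '' {m | 0 < m ∧ R m (k + 1)}) := by
  induction hg using Submodule.span_induction with
  | mem g hg =>
    obtain ⟨m, ⟨hm, hmk⟩, rfl⟩ := hg
    refine Submodule.span_mono ?_ (hφ.mul_X m hm)
    rintro _ ⟨m', ⟨hm', h⟩, rfl⟩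
    exact ⟨m', ⟨hm', hφ.trans h (hφ.add hmk (hφ.refl 1))⟩, rfl⟩
  | zero => rw [mul_zero]; exact zero_mem _
  | add g h _ _ h1 h2 => rw [mul_add]; exact add_mem h1 h2
  | smul a g _ h => rw [mul_smul_comm]; exact Submodule.smul_mem _ _ h

theorem IsGraded.X_pow_mul_mem (hφ : IsGraded φ R) (r : ℕ) {g : Polynomial ℚ} {k : ℕ}
    (hg : g ∈ Submodule.span ℚ (φ '' {m | 0 < m ∧ R m k})) :
    Polynomial.X ^ r * g ∈ Submodule.span ℚ (φ '' {m | 0 < m ∧ R m (r + k)}) := by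
  induction r with
  | zero => simpa using hg
  | succ r ih =>
    rw [pow_succ', mul_assoc, add_right_comm]
    exact hφ.X_mul_mem ih

theorem IsGraded.X_pow_mem (hφ : IsGraded φ R) {r : ℕ} (hr : 0 < r) :
    (Polynomial.X : Polynomial ℚ) ^ r ∈ Submodule.span ℚ (φ '' {m | 0 < m ∧ R m r}) := by
  obtain ⟨r, rfl⟩ : ∃ s, r = s + 1 := ⟨r - 1, (Nat.sub_add_cancel hr).symm⟩
  have h := hφ.X_pow_mul_mem r (g := φ 1) (k := 1)
    (Submodule.subset_span ⟨1, ⟨one_pos, hφ.refl 1⟩, rfl⟩)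
  rwa [hφ.one, ← pow_succ] at h

theorem IsGraded.one_mem (hφ : IsGraded φ R) : (1 : VarFamily K) ∈ symmSpan x φ R 0 :=
  Submodule.subset_span ⟨[], by simp, hφ.refl 0, rfl⟩

theorem psumFamily_mul_createFamily (r : ℕ) (g : Polynomial ℚ) (F : VarFamily K) :
    psumFamily x r * createFamily x g F = createFamily x (Polynomial.X ^ r * g) F +
      createFamily x g (psumFamily x r * F) :=
  _root_.funext fun _ => setPsum_mul_create _ _ _ _

theorem psumFamily_eq (hx : ∀ N, Function.Injective (x N)) (hx' : ∀ N i j, x N i + x N j ≠ 0)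
    {r : ℕ} (hr : Odd r) :
    psumFamily x r = createFamily x (Polynomial.X ^ r) 1 + ∑ k ∈ Finset.range (r - 1),
      (-1 : ℚ) ^ (k + 1) • createFamily x (Polynomial.X ^ (r - 1 - k))
        (createFamily x (Polynomial.X ^ (k + 1)) 1) := by
  funext N
  refine (setPsum_eq_create (x N) (hx N) (hx' N) hr).trans ?_
  rw [Pi.add_apply, Finset.sum_apply]
  rfl

theorem IsGraded.psumFamily_mem (hφ : IsGraded φ R) (hx : ∀ N, Function.Injective (x N))
    (hx' : ∀ N i j, x N i + x N j ≠ 0) {r : ℕ} (hr : Odd r) :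
    psumFamily x r ∈ symmSpan x φ R r := by
  rw [psumFamily_eq x hx hx' hr]
  have h0 := hφ.createFamily_mem x (hφ.X_pow_mem hr.pos) (hφ.one_mem x)
  rw [add_zero] at h0
  refine add_mem h0 (sum_mem fun k hk => ?_)
  have hk' := Finset.mem_range.1 hk
  refine Submodule.smul_mem _ _ ?_
  have h := hφ.createFamily_mem x (hφ.X_pow_mem (r := r - 1 - k) (by omega))
    (hφ.createFamily_mem x (hφ.X_pow_mem (Nat.succ_pos k)) (hφ.one_mem x))
  have e : r - 1 - k + (k + 1 + 0) = r := by omega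
  rwa [e] at h

/-- By the derivation rule `p_r` either raises one exponent or travels inward until it meets the
constant `1`. There the expansion of the odd power sum in one and two creation operators takes over.
-/
theorem IsGraded.psumFamily_mul_symmFamily_mem (hφ : IsGraded φ R) (hx : ∀ N, Function.Injective (x N))
    (hx' : ∀ N i j, x N i + x N j ≠ 0) {r : ℕ} (hr : Odd r)
    {l : List ℕ} (hl : ∀ i ∈ l, 0 < i) :
    psumFamily x r * symmFamily x φ l ∈ symmSpan x φ R (r + l.sum) := by
  induction l with
  | nil =>
    have : symmFamily x φ [] = 1 := rfl
    rw [this, mul_one]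
    exact hφ.psumFamily_mem x hx hx' hr
  | cons k l ih =>
    have hk : 0 < k := hl k List.mem_cons_self
    have hl' : ∀ i ∈ l, 0 < i := fun i hi => hl i (List.mem_cons_of_mem _ hi)
    have e : symmFamily x φ (k :: l) = createFamily x (φ k) (symmFamily x φ l) := rfl
    have hmem : φ k ∈ Submodule.span ℚ (φ '' {m | 0 < m ∧ R m k}) :=
      Submodule.subset_span ⟨k, ⟨hk, hφ.refl k⟩, rfl⟩
    rw [e, psumFamily_mul_createFamily, List.sum_cons]
    refine add_mem ?_ ?_
    · rw [← add_assoc]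
      exact hφ.createFamily_mem x (hφ.X_pow_mul_mem r hmem) (symmFamily_mem x hl' (hφ.refl _))
    · rw [add_left_comm]
      exact hφ.createFamily_mem x hmem (ih hl')

theorem IsGraded.psumFamily_mul_mem (hφ : IsGraded φ R) (hx : ∀ N, Function.Injective (x N))
    (hx' : ∀ N i j, x N i + x N j ≠ 0) {r : ℕ} (hr : Odd r) {n : ℕ}
    {F : VarFamily K} (hF : F ∈ symmSpan x φ R n) :
    psumFamily x r * F ∈ symmSpan x φ R (r + n) := by
  induction hF using Submodule.span_induction with
  | mem F hF =>
    obtain ⟨l, hl, hln, rfl⟩ := hF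
    refine Submodule.span_mono ?_ (hφ.psumFamily_mul_symmFamily_mem x hx hx' hr hl)
    rintro _ ⟨l', hl', h, rfl⟩
    exact ⟨l', hl', hφ.trans h (hφ.add (hφ.refl r) hln), rfl⟩
  | zero => rw [mul_zero]; exact zero_mem _
  | add F G _ _ h1 h2 => rw [mul_add]; exact add_mem h1 h2
  | smul a F _ h => rw [mul_smul_comm]; exact Submodule.smul_mem _ _ h

theorem IsGraded.prod_psumFamily_mem (hφ : IsGraded φ R) (hx : ∀ N, Function.Injective (x N))
    (hx' : ∀ N i j, x N i + x N j ≠ 0) {l : List ℕ} (hl : ∀ i ∈ l, Odd i) :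
    (l.map (psumFamily x)).prod ∈ symmSpan x φ R l.sum := by
  induction l with
  | nil => exact hφ.one_mem x
  | cons r l ih =>
    rw [List.map_cons, List.prod_cons, List.sum_cons]
    exact hφ.psumFamily_mul_mem x hx hx' (hl r List.mem_cons_self)
      (ih fun i hi => hl i (List.mem_cons_of_mem _ hi))

/-! ### Straightening -/

theorem symmFamily_perm {l l' : List ℕ} (h : l.Perm l') :
    ∃ a : ℚ, symmFamily x φ l = a • symmFamily x φ l' := by
  induction h with
  | nil => exact ⟨1, (one_smul _ _).symm⟩
  | cons k _ ih =>
    obtain ⟨a, ha⟩ := ih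
    exact ⟨a, (congrArg (createFamily x (φ k)) ha).trans (createFamily_apply_smul x a _ _)⟩
  | swap k m l =>
    refine ⟨-1, ?_⟩
    rw [neg_one_smul]
    exact _root_.funext fun _ => create_comm _ _ _ _
  | trans _ _ ih1 ih2 =>
    obtain ⟨a, ha⟩ := ih1
    obtain ⟨b, hb⟩ := ih2
    exact ⟨a * b, by rw [ha, hb, mul_smul]⟩

/-- Sorting the exponents changes a symmetrization only by a scalar, and a sorted list with a
repetition gives zero. -/
theorem symmSpan_le (n : ℕ) : symmSpan x φ R n ≤ Submodule.span ℚ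
    ((fun lam : StrictPartition => symmFamily x φ lam.parts) '' {lam | R lam.size n}) := by
  refine Submodule.span_le.2 ?_
  rintro _ ⟨l, hl, hln, rfl⟩
  set l' := l.insertionSort (· ≥ ·) with hl'
  have hp : l'.Perm l := List.perm_insertionSort _ l
  have hs : l'.Pairwise (· ≥ ·) := List.pairwise_insertionSort _ l
  obtain ⟨a, ha⟩ := symmFamily_perm x (φ := φ) hp.symm
  rw [ha]
  by_cases hstrict : l'.Pairwise (· > ·)
  · refine Submodule.smul_mem _ _ (Submodule.subset_span
      ⟨⟨l', fun i hi => hl i (hp.mem_iff.1 hi), hstrict⟩, ?_, rfl⟩)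
    change R l'.sum n
    rwa [hp.sum_eq]
  · have : symmFamily x φ l' = 0 :=
      _root_.funext fun N => createList_eq_zero_of_not_strict (x N) φ hs hstrict
    rw [this, smul_zero]
    exact zero_mem _

end Families

/-! ### The graded family of powers and the filtered family of descending powers -/

theorem isGraded_pow : IsGraded (fun k => Polynomial.X ^ k) Eq where
  refl _ := rfl
  trans := Eq.trans
  add h h' := by rw [h, h']
  one := pow_one _
  mul_X k _ := Submodule.subset_span ⟨k + 1, ⟨Nat.succ_pos k, rfl⟩, pow_succ' _ _⟩

theorem IsGraded.of_eq {φ : ℕ → Polynomial ℚ} (h : IsGraded φ Eq) : IsGraded φ (· ≤ ·) where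
  refl := le_refl
  trans := le_trans
  add := add_le_add
  one := h.one
  mul_X k hk := Submodule.span_mono (Set.image_mono
    (show {m | 0 < m ∧ m = k + 1} ⊆ {m | 0 < m ∧ m ≤ k + 1} from fun _ hm => ⟨hm.1, hm.2.le⟩)) (h.mul_X k hk)

theorem X_mul_descPochhammer (k : ℕ) : Polynomial.X * descPochhammer ℚ k =
    descPochhammer ℚ (k + 1) + (k : ℚ) • descPochhammer ℚ k := by
  rw [descPochhammer_succ_right, Polynomial.smul_eq_C_mul]
  simp only [map_natCast]
  ring

/-- From `x · x^{↓k} = x^{↓(k+1)} + k x^{↓k}`. The lower term means that degrees are controlled only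
up to `≤`, whereas for the powers equality is available. -/
theorem isGraded_descPochhammer : IsGraded (fun k => descPochhammer ℚ k) (· ≤ ·) where
  refl := le_refl
  trans := le_trans
  add := add_le_add
  one := descPochhammer_one ℚ
  mul_X k hk := by
    rw [X_mul_descPochhammer]
    exact add_mem (Submodule.subset_span ⟨k + 1, ⟨Nat.succ_pos k, le_rfl⟩, rfl⟩)
      (Submodule.smul_mem _ _ (Submodule.subset_span ⟨k, ⟨hk, Nat.le_succ k⟩, rfl⟩))

/-! ### Euler's bijection between odd and strict partitions -/

/-- An odd partition as a Mathlib partition of its size. -/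
def OddPartition.toOdds (n : ℕ) (rho : {rho : OddPartition // rho.size = n}) :
    {p : n.Partition // p ∈ Nat.Partition.odds n} :=
  ⟨⟨(rho.1.parts : Multiset ℕ), fun {i} hi => (rho.1.odd i (by simpa using hi)).pos,
      by simpa [OddPartition.size] using rho.2⟩, by
    simp only [Nat.Partition.odds, Nat.Partition.restricted, Finset.mem_filter, Finset.mem_univ,
      true_and, Multiset.mem_coe]
    exact fun i hi => Nat.not_even_iff_odd.2 (rho.1.odd i hi)⟩

theorem OddPartition.toOdds_bijective (n : ℕ) : Function.Bijective (OddPartition.toOdds n) := by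
  constructor
  · rintro ⟨a, ha⟩ ⟨b, hb⟩ h
    have h1 : (a.parts : Multiset ℕ) = (b.parts : Multiset ℕ) :=
      congrArg (fun p => p.1.parts) h
    exact Subtype.ext (OddPartition.ext ((Multiset.coe_eq_coe.1 h1).eq_of_pairwise
      (le := fun i j => i ≥ j) (fun x y _ _ hxy hyx => le_antisymm hyx hxy) a.sorted b.sorted))
  · rintro ⟨p, hp⟩
    simp only [Nat.Partition.odds, Nat.Partition.restricted, Finset.mem_filter, Finset.mem_univ,
      true_and] at hp
    refine ⟨⟨⟨p.parts.sort (· ≥ ·), fun i hi => ?_, Multiset.pairwise_sort _ _⟩, ?_⟩, ?_⟩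
    · exact Nat.not_even_iff_odd.1 (hp i (by simpa using hi))
    · rw [OddPartition.size, ← Multiset.sum_coe, Multiset.sort_eq, p.parts_sum]
    · exact Subtype.ext (Nat.Partition.ext (Multiset.sort_eq _ _))

/-- A strict partition as a Mathlib partition of its size. -/
def StrictPartition.toDistincts (n : ℕ) (lam : {lam : StrictPartition // lam.size = n}) :
    {p : n.Partition // p ∈ Nat.Partition.distincts n} :=
  ⟨⟨(lam.1.parts : Multiset ℕ), fun {i} hi => lam.1.pos i (by simpa using hi),
      by simpa [StrictPartition.size] using lam.2⟩, by
    simp only [Nat.Partition.distincts, Finset.mem_filter, Finset.mem_univ,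
      true_and, Multiset.coe_nodup]
    exact lam.1.sorted.imp fun h => ne_of_gt h⟩

theorem StrictPartition.parts_perm_inj {a b : StrictPartition} (h : a.parts.Perm b.parts) :
    a = b :=
  StrictPartition.ext (h.eq_of_pairwise (le := fun i j => i > j)
    (fun _ _ _ _ hxy hyx => absurd hxy (not_lt_of_gt hyx)) a.sorted b.sorted)

theorem StrictPartition.toDistincts_bijective (n : ℕ) :
    Function.Bijective (StrictPartition.toDistincts n) := by
  constructor
  · rintro ⟨a, ha⟩ ⟨b, hb⟩ h
    have h1 : (a.parts : Multiset ℕ) = (b.parts : Multiset ℕ) :=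
      congrArg (fun p => p.1.parts) h
    exact Subtype.ext (StrictPartition.parts_perm_inj (Multiset.coe_eq_coe.1 h1))
  · rintro ⟨p, hp⟩
    simp only [Nat.Partition.distincts, Finset.mem_filter, Finset.mem_univ, true_and] at hp
    have hs := Multiset.pairwise_sort p.parts (· ≥ ·)
    have hn : (p.parts.sort (· ≥ ·)).Nodup := by
      rw [← Multiset.coe_nodup, Multiset.sort_eq]; exact hp
    refine ⟨⟨⟨p.parts.sort (· ≥ ·), fun i hi => p.parts_pos (by simpa using hi), ?_⟩, ?_⟩, ?_⟩
    · exact (hs.and hn).imp fun h => lt_of_le_of_ne h.1 h.2.symm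
    · rw [StrictPartition.size, ← Multiset.sum_coe, Multiset.sort_eq, p.parts_sum]
    · exact Subtype.ext (Nat.Partition.ext (Multiset.sort_eq _ _))

theorem nonempty_odd_equiv_strict (n : ℕ) :
    Nonempty ({rho : OddPartition // rho.size = n} ≃ {lam : StrictPartition // lam.size = n}) := by
  have e := Fintype.equivOfCardEq (α := {p : n.Partition // p ∈ Nat.Partition.odds n})
    (β := {p : n.Partition // p ∈ Nat.Partition.distincts n})
    (by rw [Fintype.card_coe, Fintype.card_coe, Nat.Partition.card_odds_eq_card_distincts])
  exact ⟨(Equiv.ofBijective _ (OddPartition.toOdds_bijective n)).trans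
    (e.trans (Equiv.ofBijective _ (StrictPartition.toDistincts_bijective n)).symm)⟩

/-- A size-preserving bijection between odd and strict partitions. -/
theorem exists_odd_equiv_strict :
    ∃ e : OddPartition ≃ StrictPartition, ∀ rho, (e rho).size = rho.size := by
  have e := fun n => (nonempty_odd_equiv_strict n).some
  refine ⟨(Equiv.sigmaFiberEquiv OddPartition.size).symm.trans ((Equiv.sigmaCongrRight fun n =>
    e n).trans (Equiv.sigmaFiberEquiv StrictPartition.size)), fun rho => ?_⟩
  exact (e rho.size ⟨rho, rfl⟩).2

/-! ### A dimension count -/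

/-- If `|A|` independent vectors lie in the span of `|A|` vectors, the two spans coincide and the
second family is independent as well. -/
theorem mem_span_of_linearIndependent {I M : Type*} [AddCommGroup M] [Module ℚ M] {u v : I → M}
    (hu : LinearIndependent ℚ u) {A : Set I} (hA : A.Finite)
    (h : ∀ i ∈ A, u i ∈ Submodule.span ℚ (v '' A)) :
    (∀ i ∈ A, v i ∈ Submodule.span ℚ (u '' A)) ∧
      LinearIndependent ℚ (fun i : A => v i) := by
  have := hA.fintype
  have hu' : LinearIndependent ℚ (fun i : A => u i) := hu.comp _ Subtype.val_injective
  rw [Set.image_eq_range] at h ⊢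
  have hle : Submodule.span ℚ (Set.range fun i : A => u i) ≤
      Submodule.span ℚ (Set.range fun i : A => v i) :=
    Submodule.span_le.2 (by rintro _ ⟨i, rfl⟩; exact h i i.2)
  have h1 := linearIndependent_iff_card_eq_finrank_span.1 hu'
  have : FiniteDimensional ℚ (Submodule.span ℚ (Set.range fun i : A => v i)) :=
    FiniteDimensional.span_of_finite ℚ (Set.finite_range _)
  have h2 : (Set.range fun i : A => v i).finrank ℚ ≤ Fintype.card A := finrank_range_le_card _
  have h3 := Submodule.finrank_mono hle
  have heq := Submodule.eq_of_le_of_finrank_le hle (by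
    rw [Set.finrank] at h1 h2; omega)
  refine ⟨fun i hi => ?_, ?_⟩
  · rw [heq]; exact Submodule.subset_span ⟨⟨i, hi⟩, rfl⟩
  · rw [linearIndependent_iff_card_le_finrank_span, Set.finrank, ← heq]
    exact h1.le

/-! ### The basis of power sum products -/

theorem OddPartition.parts_perm_inj {a b : OddPartition} (h : a.parts.Perm b.parts) : a = b :=
  OddPartition.ext (h.eq_of_pairwise (le := fun i j => i ≥ j)
    (fun _ _ _ _ hxy hyx => le_antisymm hyx hxy) a.sorted b.sorted)

theorem powerSumProd_apply (rho : OddPartition) (N : ℕ) :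
    (powerSumProd rho).1 N = (rho.parts.map (psum (Fin N) ℚ)).prod := by
  change ((rho.parts.map powerSum).prod) N = _
  rw [Pi.list_prod_apply, List.map_map]
  rfl

theorem prod_psum_eq_sum (l : List ℕ) (N : ℕ) : (l.map (psum (Fin N) ℚ)).prod =
    ∑ g : Fin l.length → Fin N, monomial (∑ k, Finsupp.single (g k) l[k]) (1 : ℚ) := by
  rw [← Fin.prod_univ_fun_getElem]
  simp only [psum]
  rw [Finset.prod_univ_sum, Fintype.piFinset_univ]
  refine Finset.sum_congr rfl fun g _ => ?_
  rw [monomial_sum_one]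
  refine Finset.prod_congr rfl fun k _ => ?_
  exact X_pow_eq_monomial

/-- The exponent vector of a list. -/
def listExponent (l : List ℕ) : Fin l.length →₀ ℕ := Finsupp.equivFunOnFinite.symm fun i => l[i]

/-- A monomial in the expanded product is a map `g` from the parts of `l'` to the variables. Every
exponent of the target monomial is positive, so `g` is onto; since `l'` is not longer than `l`, it
is a bijection matching parts. -/
theorem perm_of_coeff_ne_zero {l l' : List ℕ} (hl : ∀ i ∈ l, 0 < i) (hlen : l'.length ≤ l.length)
    (h : coeff (listExponent l) (l'.map (psum (Fin l.length) ℚ)).prod ≠ 0) : l'.Perm l := by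
  rw [prod_psum_eq_sum, coeff_sum] at h
  obtain ⟨g, -, hg⟩ := Finset.exists_ne_zero_of_sum_ne_zero h
  have hg' : ∑ k, Finsupp.single (g k) l'[k] = listExponent l := by
    by_contra hne
    rw [coeff_monomial, if_neg hne] at hg
    exact hg rfl
  have hval : ∀ i : Fin l.length, ∑ k, (if g k = i then l'[k] else 0) = l[i] := by
    intro i
    have := DFunLike.congr_fun hg' i
    rw [Finsupp.finsetSum_apply] at this
    simpa [Finsupp.single_apply, listExponent] using this
  have hsurj : Function.Surjective g := by
    intro i
    by_contra hne
    push Not at hne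
    have h0 := hval i
    rw [Finset.sum_eq_zero fun k _ => if_neg (hne k)] at h0
    exact (hl _ (List.getElem_mem i.2)).ne h0
  have hbij : Function.Bijective g := by
    refine (Fintype.bijective_iff_surjective_and_card g).2 ⟨hsurj, ?_⟩
    have := Fintype.card_le_of_surjective g hsurj
    simp only [Fintype.card_fin] at this ⊢
    omega
  have hval' : ∀ k : Fin l'.length, l'[k] = l[g k] := by
    intro k
    rw [← hval (g k), Finset.sum_eq_single k]
    · rw [if_pos rfl]
    · intro b _ hb; exact if_neg (hbij.1.ne hb)
    · intro hk; exact absurd (Finset.mem_univ _) hk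
  rw [← Multiset.coe_eq_coe]
  have e1 : ∀ l : List ℕ, (l : Multiset ℕ) = (Finset.univ : Finset (Fin l.length)).val.map
      fun k => l[k] := by
    intro l
    conv_lhs => rw [← List.ofFn_getElem (xs := l)]
    exact Fin.univ_val_map _ |>.symm
  rw [e1 l', e1 l]
  have := Multiset.map_univ_val_equiv (Equiv.ofBijective g hbij)
  rw [← this, Multiset.map_map]
  exact Multiset.map_congr rfl fun k _ => hval' k

/-- All contributions are nonnegative and the identity assignment contributes `1`. -/
theorem coeff_listExponent_self (l : List ℕ) :
    coeff (listExponent l) (l.map (psum (Fin l.length) ℚ)).prod ≠ 0 := by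
  rw [prod_psum_eq_sum, coeff_sum]
  refine ne_of_gt (Finset.sum_pos' (fun g _ => ?_) ⟨id, Finset.mem_univ _, ?_⟩)
  · rw [coeff_monomial]; split_ifs <;> norm_num
  · rw [coeff_monomial, if_pos]
    · exact one_pos
    · ext i
      rw [Finsupp.finsetSum_apply]
      simp [Finsupp.single_apply, listExponent]

/-- In a vanishing combination take `σ` with the most parts among the nonzero terms, and pass to
`ℓ(σ)` variables. The coefficient of the monomial with exponents `σ` then isolates `p_σ`. -/
theorem linearIndependent_powerSumProd : LinearIndependent ℚ powerSumProd := by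
  rw [linearIndependent_iff']
  intro s c hc rho hrho
  by_contra hne
  have hne' : (s.filter fun rho => c rho ≠ 0).Nonempty := ⟨rho, by simp [hrho, hne]⟩
  obtain ⟨σ, hσ, hmax⟩ := Finset.exists_max_image _ (fun rho => rho.parts.length) hne'
  rw [Finset.mem_filter] at hσ
  have h1 := congrArg (fun f : Supersym => coeff (listExponent σ.parts) (f.1 σ.parts.length)) hc
  have h2 : ∑ τ ∈ s, c τ * coeff (listExponent σ.parts)
      (τ.parts.map (psum (Fin σ.parts.length) ℚ)).prod = 0 := by
    simp only [← powerSumProd_apply]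
    simpa [Finset.sum_apply, coeff_sum] using h1
  rw [Finset.sum_eq_single σ] at h2
  · exact mul_ne_zero hσ.2 (coeff_listExponent_self _) h2
  · intro τ hτ hτσ
    by_contra h0
    have hcτ : c τ ≠ 0 := left_ne_zero_of_mul h0
    exact hτσ (OddPartition.parts_perm_inj (perm_of_coeff_ne_zero (fun i hi => (σ.odd i hi).pos)
      (hmax τ (Finset.mem_filter.2 ⟨hτ, hcτ⟩)) (right_ne_zero_of_mul h0)))
  · intro h; exact absurd hσ.1 h

/-- The odd partition with the given parts. -/
def OddPartition.ofList (l : List ℕ) (hl : ∀ i ∈ l, Odd i) : OddPartition where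
  parts := l.insertionSort (· ≥ ·)
  odd i hi := hl i ((List.perm_insertionSort _ l).mem_iff.1 hi)
  sorted := List.pairwise_insertionSort _ l

theorem powerSumProd_ofList (l : List ℕ) (hl : ∀ i ∈ l, Odd i) :
    (powerSumProd (OddPartition.ofList l hl)).1 = (l.map powerSum).prod :=
  ((List.perm_insertionSort _ l).map _).prod_eq

theorem span_powerSumProd : Submodule.span ℚ (Set.range powerSumProd) = ⊤ := by
  rw [eq_top_iff]
  rintro ⟨f, hf⟩ -
  have hf' : f ∈ Submodule.span ℚ (Submonoid.closure {F | ∃ r : ℕ, Odd r ∧ F = powerSum r} :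
      Set (∀ N : ℕ, MvPolynomial (Fin N) ℚ)) := by
    rw [← Algebra.adjoin_eq_span]; exact hf
  have key : Submodule.span ℚ (Submonoid.closure {F | ∃ r : ℕ, Odd r ∧ F = powerSum r} :
      Set (∀ N : ℕ, MvPolynomial (Fin N) ℚ)) ≤
      (Submodule.span ℚ (Set.range powerSumProd)).map Supersym.val.toLinearMap := by
    refine Submodule.span_le.2 fun F hF => ?_
    obtain ⟨l, hl, rfl⟩ := Submonoid.exists_list_of_mem_closure hF
    have : ∃ m : List ℕ, (∀ i ∈ m, Odd i) ∧ m.map powerSum = l := by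
      clear hF
      induction l with
      | nil => exact ⟨[], by simp, rfl⟩
      | cons F l ih =>
        obtain ⟨m, hm, rfl⟩ := ih fun y hy => hl y (List.mem_cons_of_mem _ hy)
        obtain ⟨r, hr, rfl⟩ := hl F List.mem_cons_self
        exact ⟨r :: m, by simpa using ⟨hr, hm⟩, rfl⟩
    obtain ⟨m, hm, rfl⟩ := this
    exact ⟨powerSumProd (OddPartition.ofList m hm), Submodule.subset_span ⟨_, rfl⟩,
      powerSumProd_ofList m hm⟩
  obtain ⟨g, hg, hgf⟩ := key hf'
  have : g = ⟨f, hf⟩ := Subtype.ext hgf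
  rwa [← this]

/-- The basis of `Γ` consisting of the products of odd power sums. -/
def powerSumBasis : Module.Basis OddPartition ℚ Supersym :=
  Module.Basis.mk linearIndependent_powerSumProd span_powerSumProd.ge

@[simp] theorem powerSumBasis_apply (rho : OddPartition) :
    powerSumBasis rho = powerSumProd rho := Module.Basis.mk_apply _ _ _

/-! ### Symmetrizations are supersymmetric functions -/

theorem finite_odd_size_le (n : ℕ) : {rho : OddPartition | rho.size ≤ n}.Finite := by
  obtain ⟨e, he⟩ := exists_odd_equiv_strict
  have h : {rho : OddPartition | rho.size ≤ n} =
      e ⁻¹' ⋃ m ∈ Finset.range (n + 1), {lam : StrictPartition | lam.size = m} := by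
    ext rho
    simp [he]
  rw [h]
  exact (Set.Finite.biUnion (Finset.finite_toSet _)
    fun m _ => StrictPartition.finite_size_eq m).preimage e.injective.injOn

section Abstract

set_option linter.unusedSectionVars false

variable {K : ℕ → Type*} [∀ N, Field (K N)] [∀ N, CharZero (K N)] {x : ∀ N, Fin N → K N}
  {φ : ℕ → Polynomial ℚ} {R : ℕ → ℕ → Prop} {ev : Supersym →ₗ[ℚ] ∀ N, K N}

/-- The symmetrizations in all variables. -/
def symmTotal (x : ∀ N, Fin N → K N) (φ : ℕ → Polynomial ℚ) (lam : StrictPartition) : ∀ N, K N :=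
  fun N => createList (x N) (lam.parts.map φ) Finset.univ

theorem IsGraded.powerSumProd_mem (hφ : IsGraded φ R) (hx : ∀ N, Function.Injective (x N))
    (hx' : ∀ N i j, x N i + x N j ≠ 0)
    (hev : ∀ rho : OddPartition, ev (powerSumProd rho) =
      fun N => (rho.parts.map fun r => ∑ i, x N i ^ r).prod) (rho : OddPartition) :
    ev (powerSumProd rho) ∈ Submodule.span ℚ (symmTotal x φ '' {lam | R lam.size rho.size}) := by
  have h := symmSpan_le x rho.size (hφ.prod_psumFamily_mem x hx hx' rho.odd)
  let E : VarFamily K →+ ∀ N, K N :=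
    { toFun := fun F N => F N Finset.univ
      map_zero' := rfl
      map_add' := fun _ _ => rfl }
  have h2 := Submodule.mem_map_of_mem (f := E.toRatLinearMap) h
  rw [Submodule.map_span, Set.image_image] at h2
  have h3 : E.toRatLinearMap (rho.parts.map (psumFamily x)).prod = ev (powerSumProd rho) := by
    rw [hev]
    funext N
    change (rho.parts.map (psumFamily x)).prod N Finset.univ = _
    rw [Pi.list_prod_apply, Pi.list_prod_apply, List.map_map, List.map_map]
    rfl
  rw [h3] at h2
  exact h2

/-- The reversal of the inclusion: products of power sums were shown to lie in the span of the
symmetrizations, and Euler's bijection makes the two index sets equinumerous in each degree range.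
Membership of the symmetrizations in `Γ` is thus an output of the dimension count. The relation `R`
is equality in the homogeneous case and `≤` in the filtered one. -/
theorem IsGraded.count (hφ : IsGraded φ R) (hx : ∀ N, Function.Injective (x N))
    (hx' : ∀ N i j, x N i + x N j ≠ 0) (hinj : Function.Injective ev)
    (hev : ∀ rho : OddPartition, ev (powerSumProd rho) =
      fun N => (rho.parts.map fun r => ∑ i, x N i ^ r).prod)
    (hR : ∀ m n, R m n → m ≤ n) (n : ℕ) :
    (∀ lam : StrictPartition, R lam.size n → ∃ f ∈ Submodule.span ℚ
      (powerSumProd '' {rho | R rho.size n}), ev f = symmTotal x φ lam) ∧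
    LinearIndependent ℚ (fun lam : {lam : StrictPartition | R lam.size n} =>
      symmTotal x φ lam) := by
  obtain ⟨e, he⟩ := exists_odd_equiv_strict
  have hu : LinearIndependent ℚ (fun rho => ev (powerSumProd rho)) :=
    linearIndependent_powerSumProd.map' ev (LinearMap.ker_eq_bot.2 hinj)
  have hA : {rho : OddPartition | R rho.size n}.Finite :=
    (finite_odd_size_le n).subset fun rho h => hR _ _ h
  have key := mem_span_of_linearIndependent (v := fun rho => symmTotal x φ (e rho)) hu hA ?_
  · constructor
    · intro lam hlam
      have h := key.1 (e.symm lam) (by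
        change R (e.symm lam).size n
        rwa [← he, e.apply_symm_apply])
      rw [e.apply_symm_apply] at h
      have himg : (fun rho => ev (powerSumProd rho)) '' {rho | R rho.size n} =
          ev '' (powerSumProd '' {rho | R rho.size n}) := by rw [Set.image_image]
      rw [himg, Submodule.span_image] at h
      obtain ⟨f, hf, hfe⟩ := h
      exact ⟨f, hf, hfe⟩
    · let e' : {lam : StrictPartition | R lam.size n} → {rho : OddPartition | R rho.size n} :=
        fun lam => ⟨e.symm lam.1, by
          change R (e.symm lam.1).size n
          rw [← he, e.apply_symm_apply]; exact lam.2⟩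
      have h := key.2.comp e' fun a b hab => Subtype.ext
        (e.symm.injective (congrArg Subtype.val hab))
      have e2 : (fun rho : {rho : OddPartition | R rho.size n} => symmTotal x φ (e rho)) ∘ e' =
          fun lam : {lam : StrictPartition | R lam.size n} => symmTotal x φ lam := by
        funext lam
        simp [e']
      rwa [e2] at h
  · intro rho hrho
    refine Submodule.span_mono ?_ (hφ.powerSumProd_mem hx hx' hev rho)
    rintro _ ⟨lam, hlam, rfl⟩
    refine ⟨e.symm lam, ?_, by simp⟩
    change R (e.symm lam).size n
    rw [← he, e.apply_symm_apply]
    exact hφ.trans hlam hrho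

/-- Any finite set of strict partitions has bounded size, so the filtered count applies. -/
theorem IsGraded.linearIndependent (hφ : IsGraded φ (· ≤ ·)) (hx : ∀ N, Function.Injective (x N))
    (hx' : ∀ N i j, x N i + x N j ≠ 0) (hinj : Function.Injective ev)
    (hev : ∀ rho : OddPartition, ev (powerSumProd rho) =
      fun N => (rho.parts.map fun r => ∑ i, x N i ^ r).prod) :
    LinearIndependent ℚ (symmTotal x φ) := by
  rw [linearIndependent_iff_finset_linearIndependent]
  intro s
  have h := (hφ.count hx hx' hinj hev (fun _ _ h => h) (s.sup StrictPartition.size)).2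
  exact h.comp (fun lam : s => ⟨lam.1, Finset.le_sup (f := StrictPartition.size) lam.2⟩)
    fun a b hab =>
    Subtype.ext (by simpa using hab)

variable [∀ N, Algebra (MvPolynomial (Fin N) ℚ) (K N)]
  [∀ N, IsFractionRing (MvPolynomial (Fin N) ℚ) (K N)]

variable (K) in
/-- The members of a supersymmetric function as rational functions. -/
def toFraction : Supersym →+ ∀ N, K N where
  toFun f N := algebraMap (MvPolynomial (Fin N) ℚ) (K N) (f.1 N)
  map_zero' := _root_.funext fun _ => map_zero _
  map_add' _ _ := _root_.funext fun _ => map_add _ _ _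

variable (K) in
/-- The variables as rational functions. -/
def fractionVar (N : ℕ) (i : Fin N) : K N := algebraMap (MvPolynomial (Fin N) ℚ) (K N) (X i)

theorem fractionVar_injective (N : ℕ) : Function.Injective (fractionVar K N) :=
  (IsFractionRing.injective (MvPolynomial (Fin N) ℚ) (K N)).comp X_injective

theorem fractionVar_add_ne_zero (N : ℕ) (i j : Fin N) :
    fractionVar K N i + fractionVar K N j ≠ 0 := by
  rw [fractionVar, fractionVar, ← map_add]
  refine (map_ne_zero_iff _ (IsFractionRing.injective (MvPolynomial (Fin N) ℚ) (K N))).2 ?_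
  intro h
  have := congrArg (MvPolynomial.eval (fun _ => (1 : ℚ))) h
  norm_num at this

variable (K) in
theorem toFraction_injective : Function.Injective (toFraction K) := fun _ _ h =>
  Subtype.ext (_root_.funext fun N =>
    IsFractionRing.injective (MvPolynomial (Fin N) ℚ) (K N) (congrFun h N))

theorem toFraction_powerSumProd (rho : OddPartition) : toFraction K (powerSumProd rho) =
    fun N => (rho.parts.map fun r => ∑ i, fractionVar K N i ^ r).prod := by
  funext N
  change algebraMap (MvPolynomial (Fin N) ℚ) (K N) ((powerSumProd rho).1 N) = _
  rw [powerSumProd_apply, map_list_prod, List.map_map]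
  congr 2
  funext r
  simp [psum, fractionVar]

variable (K) in
theorem IsGraded.exists_mem_span (hφ : IsGraded φ R)
    (hR : ∀ m n, R m n → m ≤ n) (lam : StrictPartition) :
    ∃ f ∈ Submodule.span ℚ (powerSumProd '' {rho | R rho.size lam.size}),
      toFraction K f = symmTotal (fractionVar K) φ lam :=
  (hφ.count (ev := (toFraction K).toRatLinearMap) fractionVar_injective
    fractionVar_add_ne_zero (toFraction_injective K) toFraction_powerSumProd hR
    lam.size).1 lam (hφ.refl _)

theorem IsGraded.linearIndependent_of_toFraction (hφ : IsGraded φ (· ≤ ·))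
    {v : StrictPartition → Supersym}
    (hv : ∀ lam, toFraction K (v lam) = symmTotal (fractionVar K) φ lam) :
    LinearIndependent ℚ v := by
  refine LinearIndependent.of_comp (toFraction K).toRatLinearMap ?_
  have e : (toFraction K).toRatLinearMap ∘ v = symmTotal (fractionVar K) φ := _root_.funext hv
  rw [e]
  exact hφ.linearIndependent (ev := (toFraction K).toRatLinearMap) fractionVar_injective
    fractionVar_add_ne_zero (toFraction_injective K) toFraction_powerSumProd

theorem IsGraded.mem_span_of_toFraction (hφ : IsGraded φ R)
    {v : StrictPartition → Supersym}
    (hv : ∀ lam, toFraction K (v lam) = symmTotal (fractionVar K) φ lam) (rho : OddPartition) :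
    powerSumProd rho ∈ Submodule.span ℚ (v '' {lam | R lam.size rho.size}) := by
  have h := hφ.powerSumProd_mem (ev := (toFraction K).toRatLinearMap) fractionVar_injective
    fractionVar_add_ne_zero toFraction_powerSumProd rho
  have e : symmTotal (fractionVar K) φ '' {lam | R lam.size rho.size} =
      (toFraction K).toRatLinearMap '' (v '' {lam | R lam.size rho.size}) := by
    rw [Set.image_image]
    exact Set.image_congr fun lam _ => (hv lam).symm
  rw [e, Submodule.span_image] at h
  obtain ⟨g, hg, hge⟩ := h
  rwa [← toFraction_injective K hge]

end Abstract

theorem exists_eq_symmetrization {φ : ℕ → Polynomial ℚ} {R : ℕ → ℕ → Prop} (hφ : IsGraded φ R)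
    (hR : ∀ m n, R m n → m ≤ n) (lam : StrictPartition) :
    ∃ f ∈ Submodule.span ℚ (powerSumProd '' {rho | R rho.size lam.size}),
      ∀ N, algebraMap (MvPolynomial (Fin N) ℚ) (RationalFn N) (f.1 N) = symmetrization φ lam N := by
  obtain ⟨f, hf, h⟩ := hφ.exists_mem_span RationalFn hR lam
  refine ⟨f, hf, fun N => ?_⟩
  rw [symmetrization_eq_createList]
  exact congrFun h N

theorem symmetrizationFun_spec {φ : ℕ → Polynomial ℚ} (hφ : IsGraded φ (· ≤ ·))
    (lam : StrictPartition) (N : ℕ) :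
    algebraMap (MvPolynomial (Fin N) ℚ) (RationalFn N) ((symmetrizationFun φ lam).1 N) =
      createList ratVar (lam.parts.map φ) Finset.univ := by
  obtain ⟨f, -, hf⟩ := exists_eq_symmetrization hφ (fun _ _ h => h) lam
  have hex : ∃ f : Supersym, ∀ N, algebraMap (MvPolynomial (Fin N) ℚ) (RationalFn N) (f.1 N) =
      symmetrization φ lam N := ⟨f, hf⟩
  rw [symmetrizationFun, dif_pos hex, hex.choose_spec, symmetrization_eq_createList]

theorem toFraction_symmetrizationFun {φ : ℕ → Polynomial ℚ} (hφ : IsGraded φ (· ≤ ·))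
    (lam : StrictPartition) : toFraction RationalFn (symmetrizationFun φ lam) =
      symmTotal (fractionVar RationalFn) φ lam :=
  _root_.funext fun N => symmetrizationFun_spec hφ lam N

theorem linearIndependent_symmetrizationFun {φ : ℕ → Polynomial ℚ} (hφ : IsGraded φ (· ≤ ·)) :
    LinearIndependent ℚ (symmetrizationFun φ) :=
  hφ.linearIndependent_of_toFraction (toFraction_symmetrizationFun hφ)

theorem powerSumProd_mem_span {φ : ℕ → Polynomial ℚ} {R : ℕ → ℕ → Prop} (hφ : IsGraded φ R)
    (hφ' : IsGraded φ (· ≤ ·)) (rho : OddPartition) :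
    powerSumProd rho ∈ Submodule.span ℚ (symmetrizationFun φ '' {lam | R lam.size rho.size}) :=
  hφ.mem_span_of_toFraction (toFraction_symmetrizationFun hφ') rho

theorem span_symmetrizationFun {φ : ℕ → Polynomial ℚ} (hφ : IsGraded φ (· ≤ ·)) :
    Submodule.span ℚ (Set.range (symmetrizationFun φ)) = ⊤ := by
  rw [eq_top_iff, ← span_powerSumProd]
  refine Submodule.span_le.2 ?_
  rintro _ ⟨rho, rfl⟩
  exact Submodule.span_mono (Set.image_subset_range _ _) (powerSumProd_mem_span hφ hφ rho)

/-- The basis of `Γ` formed by the symmetrizations of a graded family of polynomials. -/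
def symmetrizationBasis {φ : ℕ → Polynomial ℚ} (hφ : IsGraded φ (· ≤ ·)) :
    Module.Basis StrictPartition ℚ Supersym :=
  Module.Basis.mk (linearIndependent_symmetrizationFun hφ) (span_symmetrizationFun hφ).ge

theorem symmetrizationBasis_apply {φ : ℕ → Polynomial ℚ} (hφ : IsGraded φ (· ≤ ·))
    (lam : StrictPartition) : symmetrizationBasis hφ lam = symmetrizationFun φ lam :=
  Module.Basis.mk_apply _ _ _

/-- Both families are bases, so the change of basis is a witness and `Psi` is not the placeholder
value. -/
theorem Psi_schurP (lam : StrictPartition) : Psi (schurP lam) = factorialSchurP lam := by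
  have h : ∃ Ψ : Supersym ≃ₗ[ℚ] Supersym, ∀ lam, Ψ (schurP lam) = factorialSchurP lam := by
    refine ⟨(symmetrizationBasis isGraded_pow.of_eq).equiv
      (symmetrizationBasis isGraded_descPochhammer) (Equiv.refl _), fun lam => ?_⟩
    rw [schurP, ← symmetrizationBasis_apply isGraded_pow.of_eq, Module.Basis.equiv_apply,
      symmetrizationBasis_apply]
    rfl
  rw [Psi, dif_pos h]
  exact h.choose_spec lam

/-- Homogeneity of `P_lam`, which the count with `R` equal to equality provides; it is needed for
the Euler-type relation under `expSpec`. -/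
theorem schurP_mem_span (lam : StrictPartition) : schurP lam ∈
    Submodule.span ℚ (powerSumProd '' {rho | rho.size = lam.size}) := by
  obtain ⟨f, hf, h⟩ := exists_eq_symmetrization isGraded_pow (fun _ _ h => h.le) lam
  have : schurP lam = f := toFraction_injective RationalFn (_root_.funext fun N => by
    refine (symmetrizationFun_spec isGraded_pow.of_eq lam N).trans ?_
    rw [← symmetrization_eq_createList]
    exact (h N).symm)
  rwa [this]

/-- The basis `𝔭_rho` of `Γ`. -/
def frakpBasis : Module.Basis OddPartition ℚ Supersym := powerSumBasis.map Psi

theorem frakpBasis_apply (rho : OddPartition) : frakpBasis rho = frakp rho := by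
  rw [frakpBasis, Module.Basis.map_apply, powerSumBasis_apply, frakp]

/-! ### Evaluation at arbitrary points -/

/-- If the members of a supersymmetric function are given by creation operators, then so are
its values in commutative `ℚ`-algebras. -/
theorem aeval_eq_createList {N : ℕ} {f : MvPolynomial (Fin N) ℚ} {fs : List (Polynomial ℚ)}
    (hf : algebraMap (MvPolynomial (Fin N) ℚ) (RationalFn N) f = createList ratVar fs Finset.univ)
    {A : Type*} [CommRing A] [Algebra ℚ A] (x : Fin N → A)
    (hx : ∀ i j, i ≠ j → IsUnit (x i - x j)) :
    aeval x f = createList x fs Finset.univ := by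
  -- Inverting only the differences of the variables gives a ring that embeds in the rational
  -- functions and also maps to `A`. The identity is pulled back along the first map and pushed
  -- forward along the second.
  let M : Submonoid (MvPolynomial (Fin N) ℚ) :=
    Submonoid.closure {g | ∃ i j, i ≠ j ∧ g = X i - X j}
  have hM : M ≤ nonZeroDivisors (MvPolynomial (Fin N) ℚ) := by
    refine Submonoid.closure_le.2 ?_
    rintro _ ⟨i, j, hij, rfl⟩
    exact mem_nonZeroDivisors_of_ne_zero (sub_ne_zero.2 fun h => hij (X_injective (R := ℚ) h))
  have hM' : M ≤ (nonZeroDivisors (MvPolynomial (Fin N) ℚ)).comap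
      (RingHom.id (MvPolynomial (Fin N) ℚ)) := hM
  let y : Fin N → Localization M := fun i =>
    algebraMap (MvPolynomial (Fin N) ℚ) (Localization M) (X i)
  have hy : ∀ i j, i ≠ j → IsUnit (y i - y j) := by
    intro i j hij
    rw [← map_sub]
    exact IsLocalization.map_units (Localization M)
      (⟨X i - X j, Submonoid.subset_closure ⟨i, j, hij, rfl⟩⟩ : M)
  have hunit : ∀ g : M, IsUnit (aeval x (g : MvPolynomial (Fin N) ℚ)) := by
    rintro ⟨g, hg⟩
    induction hg using Submonoid.closure_induction with
    | mem g hg =>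
      obtain ⟨i, j, hij, rfl⟩ := hg
      simpa using hx i j hij
    | one => simp
    | mul g h _ _ h1 h2 => rw [map_mul]; exact h1.mul h2
  let θ₁ : Localization M →ₐ[ℚ] RationalFn N :=
    (IsLocalization.map (M := M) (T := nonZeroDivisors (MvPolynomial (Fin N) ℚ)) (RationalFn N)
      (RingHom.id _) hM' : Localization M →+* RationalFn N).toRatAlgHom
  let θ₂ : Localization M →ₐ[ℚ] A :=
    (IsLocalization.lift (M := M) (g := (aeval x : MvPolynomial (Fin N) ℚ →ₐ[ℚ] A).toRingHom) hunit :
      Localization M →+* A).toRatAlgHom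
  have hθ₁ : ∀ g, θ₁ (algebraMap _ _ g) = algebraMap _ _ g := fun g =>
    IsLocalization.map_eq (S := Localization M) (Q := RationalFn N) hM' g
  have hθ₂ : ∀ g, θ₂ (algebraMap _ _ g) = aeval x g := fun g =>
    IsLocalization.lift_eq (S := Localization M) hunit g
  have hinj : Function.Injective θ₁ :=
    IsLocalization.map_injective_of_injective' M (MvPolynomial (Fin N) ℚ) (RationalFn N) hM'
      (zero_notMem_nonZeroDivisors) Function.injective_id
  have e1 := map_createList θ₁ y (ratVar : Fin N → RationalFn N) (Function.Embedding.refl _)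
    (fun i => (hθ₁ _).symm) hy fs Finset.univ
  have e2 := map_createList θ₂ y x (Function.Embedding.refl _)
    (fun i => by rw [hθ₂, aeval_X]; rfl) hy fs Finset.univ
  rw [Finset.map_refl] at e1 e2
  have e3 : algebraMap _ (Localization M) f = createList y fs Finset.univ :=
    hinj (by rw [hθ₁, e1]; exact hf)
  rw [← e2, ← e3, hθ₂]

/-! ### Adding a box -/

/-- The lists obtained by increasing one entry by `1` or by appending a `1`. -/
def raise : List ℕ → List (List ℕ)
  | [] => [[1]]
  | k :: l => ((k + 1) :: l) :: (raise l).map (k :: ·)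

/-- The lists obtained from a strictly decreasing list of positive integers by decreasing one
entry by `1`, where a last entry `1` is removed. -/
def lower : List ℕ → List (List ℕ)
  | [] => []
  | k :: l => (if k = 1 then l else (k - 1) :: l) :: (lower l).map (k :: ·)

theorem eq_of_getD_eq {a : List ℕ} : ∀ {b : List ℕ}, (∀ i ∈ a, 0 < i) → (∀ i ∈ b, 0 < i) →
    (∀ j, a.getD j 0 = b.getD j 0) → a = b := by
  induction a with
  | nil =>
    rintro (_ | ⟨k, b⟩) _ hb h
    · rfl
    · have h0 := h 0
      have := hb k (by simp)
      simp at h0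
      omega
  | cons k a ih =>
    rintro (_ | ⟨m, b⟩) ha hb h
    · have h0 := h 0
      have := ha k (by simp)
      simp at h0
      omega
    · have h0 : k = m := by simpa using h 0
      have hab : a = b := ih (fun i hi => ha i (List.mem_cons_of_mem _ hi))
        (fun i hi => hb i (List.mem_cons_of_mem _ hi)) fun j => by simpa using h (j + 1)
      rw [h0, hab]

/-- Positivity of the entries of `b` rules out a gap: a new row can only be the one directly after
the last. -/
theorem mem_raise_iff {a : List ℕ} : ∀ {b : List ℕ}, (∀ i ∈ a, 0 < i) → (∀ i ∈ b, 0 < i) →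
    (b ∈ raise a ↔ ∃ i, ∀ j, b.getD j 0 = a.getD j 0 + if j = i then 1 else 0) := by
  induction a with
  | nil =>
    intro b _ hb
    simp only [raise, List.mem_singleton]
    constructor
    · rintro rfl
      refine ⟨0, fun j => ?_⟩
      obtain _ | j := j <;> simp
    · rintro ⟨i, h⟩
      obtain _ | ⟨k, b⟩ := b
      · simpa using h i
      · have h0 := h 0
        have hk := hb k (by simp)
        obtain _ | i := i
        · obtain _ | ⟨m, b⟩ := b
          · simpa using h0
          · have h1 := h 1
            have := hb m (by simp)
            simp at h1
            omega
        · simp at h0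
          omega
  | cons k a ih =>
    intro b ha hb
    have ha' : ∀ i ∈ a, 0 < i := fun i hi => ha i (by simp [hi])
    simp only [raise, List.mem_cons, List.mem_map]
    constructor
    · rintro (rfl | ⟨c, hc, rfl⟩)
      · refine ⟨0, fun j => ?_⟩
        obtain _ | j := j <;> simp
      · obtain ⟨i, h⟩ := (ih ha' fun i hi => hb i (by simp [hi])).1 hc
        refine ⟨i + 1, fun j => ?_⟩
        obtain _ | j := j
        · simp
        · simpa using h j
    · rintro ⟨i, h⟩
      obtain _ | ⟨m, b⟩ := b
      · have := h i
        simp at this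
      · have hb' : ∀ i ∈ b, 0 < i := fun i hi => hb i (by simp [hi])
        obtain _ | i := i
        · left
          have h0 : m = k + 1 := by simpa using h 0
          rw [h0, eq_of_getD_eq hb' ha' fun j => by simpa using h (j + 1)]
        · right
          have h0 : m = k := by simpa using h 0
          exact ⟨b, (ih ha' hb').2 ⟨i, fun j => by simpa using h (j + 1)⟩, by rw [h0]⟩

theorem mem_lower_iff {a : List ℕ} : ∀ {b : List ℕ}, (∀ i ∈ a, 0 < i) → a.Pairwise (· > ·) →
    (∀ i ∈ b, 0 < i) →
    (b ∈ lower a ↔ ∃ i, ∀ j, a.getD j 0 = b.getD j 0 + if j = i then 1 else 0) := by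
  induction a with
  | nil =>
    intro b _ _ _
    simp only [lower, List.not_mem_nil, false_iff]
    rintro ⟨i, h⟩
    have := h i
    simp at this
  | cons k a ih =>
    intro b ha hs hb
    have ha' : ∀ i ∈ a, 0 < i := fun i hi => ha i (by simp [hi])
    have hk := ha k (by simp)
    rw [List.pairwise_cons] at hs
    have h1 : k = 1 → a = [] := by
      intro hk1
      refine List.eq_nil_iff_forall_not_mem.2 fun i hi => ?_
      have := hs.1 i hi
      have := ha' i hi
      omega
    simp only [lower, List.mem_cons, List.mem_map]
    constructor
    · rintro (rfl | ⟨c, hc, rfl⟩)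
      · refine ⟨0, fun j => ?_⟩
        by_cases hk1 : k = 1
        · rw [if_pos hk1, h1 hk1, hk1]
          obtain _ | j := j <;> simp
        · rw [if_neg hk1]
          obtain _ | j := j
          · simp
            omega
          · simp
      · obtain ⟨i, h⟩ := (ih ha' hs.2 fun i hi => hb i (by simp [hi])).1 hc
        refine ⟨i + 1, fun j => ?_⟩
        obtain _ | j := j
        · simp
        · simpa using h j
    · rintro ⟨i, h⟩
      obtain _ | ⟨m, b⟩ := b
      · left
        obtain _ | i := i
        · have h0 : k = 1 := by simpa using h 0
          rw [if_pos h0, h1 h0]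
        · have := h 0
          simp at this
          omega
      · have hb' : ∀ i ∈ b, 0 < i := fun i hi => hb i (by simp [hi])
        have hm := hb m (by simp)
        obtain _ | i := i
        · left
          have h0 : k = m + 1 := by simpa using h 0
          rw [if_neg (by omega), h0, eq_of_getD_eq hb' ha' fun j => by simpa using (h (j + 1)).symm]
          rfl
        · right
          have h0 : k = m := by simpa using h 0
          exact ⟨b, (ih ha' hs.2 hb').2 ⟨i, fun j => by simpa using h (j + 1)⟩, by rw [h0]⟩

theorem nodup_raise (a : List ℕ) : (raise a).Nodup := by
  induction a with
  | nil => simp [raise]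
  | cons k a ih =>
    rw [raise, List.nodup_cons]
    refine ⟨?_, ih.map fun _ _ h => List.tail_eq_of_cons_eq h⟩
    simp

theorem nodup_lower {a : List ℕ} (ha : ∀ i ∈ a, 0 < i) (hs : a.Pairwise (· > ·)) :
    (lower a).Nodup := by
  induction a with
  | nil => simp [lower]
  | cons k a ih =>
    rw [List.pairwise_cons] at hs
    rw [lower, List.nodup_cons]
    have ha' : ∀ i ∈ a, 0 < i := fun i hi => ha i (by simp [hi])
    refine ⟨?_, (ih ha' hs.2).map fun _ _ h => List.tail_eq_of_cons_eq h⟩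
    have hk := ha k (by simp)
    split_ifs with hk1
    · have : a = [] := by
        refine List.eq_nil_iff_forall_not_mem.2 fun i hi => ?_
        have := hs.1 i hi
        have := ha' i hi
        omega
      simp [this, lower]
    · simp only [List.mem_map, List.cons.injEq, not_exists, not_and]
      intro _ _ h
      omega

theorem head_le_of_mem_raise {a : List ℕ} {k : ℕ} (hk : 0 < k) (hs : ∀ i ∈ a, i < k) :
    ∀ b ∈ raise a, ∀ i ∈ b, i ≤ k := by
  induction a with
  | nil =>
    intro b hb i hi
    simp only [raise, List.mem_singleton] at hb
    subst hb
    simp only [List.mem_singleton] at hi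
    omega
  | cons m a ih =>
    intro b hb i hi
    simp only [raise, List.mem_cons, List.mem_map] at hb
    have hm := hs m (by simp)
    have ha : ∀ i ∈ a, i < k := fun i hi => hs i (by simp [hi])
    obtain rfl | ⟨c, hc, rfl⟩ := hb
    · rcases List.mem_cons.1 hi with rfl | hi
      · omega
      · exact (ha i hi).le
    · rcases List.mem_cons.1 hi with rfl | hi
      · omega
      · exact ih ha c hc i hi

/-- Raising an entry may create a tie with its predecessor but no larger violation. The tied lists
are precisely those on which symmetrizations vanish. -/
theorem pairwise_of_mem_raise {a : List ℕ} (ha : ∀ i ∈ a, 0 < i) (hs : a.Pairwise (· > ·)) :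
    ∀ b ∈ raise a, (∀ i ∈ b, 0 < i) ∧ b.Pairwise (· ≥ ·) := by
  induction a with
  | nil => intro b hb; simp only [raise, List.mem_singleton] at hb; simp [hb]
  | cons k a ih =>
    rw [List.pairwise_cons] at hs
    have ha' : ∀ i ∈ a, 0 < i := fun i hi => ha i (by simp [hi])
    have hk := ha k (by simp)
    intro b hb
    simp only [raise, List.mem_cons, List.mem_map] at hb
    obtain rfl | ⟨c, hc, rfl⟩ := hb
    · refine ⟨?_, List.pairwise_cons.2 ⟨fun i hi => ?_, hs.2.imp fun h => h.le⟩⟩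
      · simpa using ha'
      · have := hs.1 i hi
        omega
    · obtain ⟨h1, h2⟩ := ih ha' hs.2 c hc
      exact ⟨by simpa using ⟨hk, h1⟩,
        List.pairwise_cons.2 ⟨head_le_of_mem_raise hk hs.1 c hc, h2⟩⟩

theorem le_of_mem_lower {a : List ℕ} {k : ℕ} (hs : ∀ i ∈ a, i < k) :
    ∀ b ∈ lower a, ∀ i ∈ b, i < k := by
  induction a with
  | nil => simp [lower]
  | cons m a ih =>
    intro b hb i hi
    simp only [lower, List.mem_cons, List.mem_map] at hb
    have hm := hs m (by simp)
    have ha : ∀ i ∈ a, i < k := fun i hi => hs i (by simp [hi])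
    obtain rfl | ⟨c, hc, rfl⟩ := hb
    · split_ifs at hi
      · exact ha i hi
      · rcases List.mem_cons.1 hi with rfl | hi
        · omega
        · exact ha i hi
    · rcases List.mem_cons.1 hi with rfl | hi
      · omega
      · exact ih ha c hc i hi

theorem pairwise_of_mem_lower {a : List ℕ} (ha : ∀ i ∈ a, 0 < i) (hs : a.Pairwise (· > ·)) :
    ∀ b ∈ lower a, (∀ i ∈ b, 0 < i) ∧ b.Pairwise (· ≥ ·) := by
  induction a with
  | nil => simp [lower]
  | cons k a ih =>
    rw [List.pairwise_cons] at hs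
    have ha' : ∀ i ∈ a, 0 < i := fun i hi => ha i (by simp [hi])
    have hk := ha k (by simp)
    intro b hb
    simp only [lower, List.mem_cons, List.mem_map] at hb
    obtain rfl | ⟨c, hc, rfl⟩ := hb
    · split_ifs with hk1
      · exact ⟨ha', hs.2.imp fun h => h.le⟩
      · refine ⟨?_, List.pairwise_cons.2 ⟨fun i hi => ?_, hs.2.imp fun h => h.le⟩⟩
        · simp only [List.mem_cons, forall_eq_or_imp]
          exact ⟨by omega, ha'⟩
        · have := hs.1 i hi
          omega
    · obtain ⟨h1, h2⟩ := ih ha' hs.2 c hc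
      exact ⟨by simpa using ⟨hk, h1⟩,
        List.pairwise_cons.2 ⟨fun i hi => (le_of_mem_lower hs.1 c hc i hi).le, h2⟩⟩

theorem sum_of_mem_raise {a : List ℕ} : ∀ b ∈ raise a, b.sum = a.sum + 1 := by
  induction a with
  | nil => intro b hb; simp only [raise, List.mem_singleton] at hb; simp [hb]
  | cons k a ih =>
    intro b hb
    simp only [raise, List.mem_cons, List.mem_map] at hb
    obtain rfl | ⟨c, hc, rfl⟩ := hb
    · simp only [List.sum_cons]; omega
    · simp only [List.sum_cons, ih c hc]; omega

/-- The relation between strict partitions that the second diagram arises from the first one by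
adding one box. -/
def Covers (mu lam : StrictPartition) : Prop :=
  ∃ b : ℕ × ℕ, b ∉ mu.diagram ∧ lam.diagram = insert b mu.diagram

theorem mem_diagram_iff (lam : StrictPartition) (b : ℕ × ℕ) :
    b ∈ lam.diagram ↔ b.1 ≤ b.2 ∧ b.2 < lam.part b.1 + b.1 := by
  refine ⟨fun h => h.2, fun h => ⟨?_, h⟩⟩
  by_contra hl
  have : lam.part b.1 = 0 := List.getD_eq_default _ _ (not_lt.1 hl)
  omega

theorem covers_iff (mu lam : StrictPartition) :
    Covers mu lam ↔ ∃ i, ∀ j, lam.part j = mu.part j + if j = i then 1 else 0 := by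
  constructor
  · rintro ⟨⟨p, q⟩, hb, h⟩
    have hm : ∀ i j, (i ≤ j ∧ j < lam.part i + i) ↔
        (i = p ∧ j = q) ∨ (i ≤ j ∧ j < mu.part i + i) := by
      intro i j
      have := Set.ext_iff.1 h (i, j)
      rw [Set.mem_insert_iff, mem_diagram_iff, mem_diagram_iff, Prod.mk.injEq] at this
      exact this
    rw [mem_diagram_iff] at hb
    refine ⟨p, fun i => ?_⟩
    split_ifs with hi
    · subst hi
      -- Testing column `q` and the first two columns beyond row `i` of `mu` forces this row to grow
      -- by exactly one box.
      have h1 := hm i q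
      have h2 := hm i (i + mu.part i)
      have h3 := hm i (i + mu.part i + 1)
      simp only at hb
      omega
    · have h1 := hm i (i + mu.part i)
      have h2 := hm i (i + lam.part i)
      simp only [hi, false_and, false_or] at h1 h2
      omega
  · rintro ⟨i, h⟩
    refine ⟨(i, i + mu.part i), ?_, ?_⟩
    · rw [mem_diagram_iff]
      simp only
      omega
    · ext ⟨p, q⟩
      rw [Set.mem_insert_iff, mem_diagram_iff, mem_diagram_iff, Prod.mk.injEq]
      have := h p
      simp only
      split_ifs at this with hp
      · subst hp; omega
      · omega

open Classical in
/-- The strict partitions which arise from `mu` by adding a box. -/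
def upSet (mu : StrictPartition) : Finset StrictPartition :=
  (strictPartitionsOf (mu.size + 1)).filter (Covers mu)

open Classical in
/-- The strict partitions which arise from `lam` by removing a box. -/
def downSet (lam : StrictPartition) : Finset StrictPartition :=
  (strictPartitionsOf (lam.size - 1)).filter (Covers · lam)

theorem mem_strictPartitionsOf {n : ℕ} {lam : StrictPartition} :
    lam ∈ strictPartitionsOf n ↔ lam.size = n := by
  simp [strictPartitionsOf]

theorem covers_iff_mem_raise (mu lam : StrictPartition) :
    Covers mu lam ↔ lam.parts ∈ raise mu.parts := by
  rw [covers_iff, mem_raise_iff mu.pos lam.pos]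
  rfl

theorem covers_iff_mem_lower (mu lam : StrictPartition) :
    Covers mu lam ↔ mu.parts ∈ lower lam.parts := by
  rw [covers_iff, mem_lower_iff lam.pos lam.sorted mu.pos]
  rfl

theorem Covers.size_eq {mu lam : StrictPartition} (h : Covers mu lam) :
    lam.size = mu.size + 1 :=
  sum_of_mem_raise _ ((covers_iff_mem_raise mu lam).1 h)

theorem mem_upSet {mu lam : StrictPartition} : lam ∈ upSet mu ↔ Covers mu lam := by
  classical
  rw [upSet, Finset.mem_filter, mem_strictPartitionsOf]
  exact ⟨fun h => h.2, fun h => ⟨h.size_eq, h⟩⟩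

theorem mem_downSet {mu lam : StrictPartition} : mu ∈ downSet lam ↔ Covers mu lam := by
  classical
  rw [downSet, Finset.mem_filter, mem_strictPartitionsOf]
  exact ⟨fun h => h.2, fun h => ⟨by rw [h.size_eq]; rfl, h⟩⟩

theorem StrictPartition.parts_injective : Function.Injective StrictPartition.parts :=
  fun _ _ h => StrictPartition.ext h

/-- Turns a formal sum over lists into a sum over strict partitions, provided that the summand
vanishes on the lists that are not strict. -/
theorem sum_map_eq_sum_strict {M : Type*} [AddCommMonoid M] {L : List (List ℕ)} (hL : L.Nodup)
    {S : Finset StrictPartition} (hS : ∀ nu, nu ∈ S ↔ nu.parts ∈ L)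
    (hpos : ∀ b ∈ L, ∀ i ∈ b, 0 < i) {f : List ℕ → M}
    (hf : ∀ b ∈ L, ¬ b.Pairwise (· > ·) → f b = 0) :
    (L.map f).sum = ∑ nu ∈ S, f nu.parts := by
  classical
  rw [← List.sum_toFinset f hL, ← Finset.sum_image (f := f) (g := StrictPartition.parts)
    (StrictPartition.parts_injective.injOn)]
  symm
  refine Finset.sum_subset ?_ ?_
  · intro b hb
    obtain ⟨nu, hnu, rfl⟩ := Finset.mem_image.1 hb
    exact List.mem_toFinset.2 ((hS nu).1 hnu)
  · intro b hb hb'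
    have hb := List.mem_toFinset.1 hb
    refine hf b hb fun hs => hb' ?_
    exact Finset.mem_image.2 ⟨⟨b, hpos b hb, hs⟩, (hS _).2 hb, rfl⟩

theorem sum_map_raise {M : Type*} [AddCommMonoid M] (mu : StrictPartition) {f : List ℕ → M}
    (hf : ∀ b : List ℕ, b.Pairwise (· ≥ ·) → ¬ b.Pairwise (· > ·) → f b = 0) :
    ((raise mu.parts).map f).sum = ∑ nu ∈ upSet mu, f nu.parts :=
  sum_map_eq_sum_strict (nodup_raise _) (fun _ => mem_upSet.trans (covers_iff_mem_raise _ _))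
    (fun b hb => (pairwise_of_mem_raise mu.pos mu.sorted b hb).1)
    (fun b hb => hf b (pairwise_of_mem_raise mu.pos mu.sorted b hb).2)

theorem sum_map_lower {M : Type*} [AddCommMonoid M] (lam : StrictPartition) {f : List ℕ → M}
    (hf : ∀ b : List ℕ, b.Pairwise (· ≥ ·) → ¬ b.Pairwise (· > ·) → f b = 0) :
    ((lower lam.parts).map f).sum = ∑ nu ∈ downSet lam, f nu.parts :=
  sum_map_eq_sum_strict (nodup_lower lam.pos lam.sorted)
    (fun _ => mem_downSet.trans (covers_iff_mem_lower _ _))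
    (fun b hb => (pairwise_of_mem_lower lam.pos lam.sorted b hb).1)
    (fun b hb => hf b (pairwise_of_mem_lower lam.pos lam.sorted b hb).2)

/-! ### Counting tableaux -/

open Classical in
/-- The number of sequences of `m` box additions leading from `mu` to `lam`. -/
def pathCount : ℕ → StrictPartition → StrictPartition → ℕ
  | 0, mu, lam => if mu = lam then 1 else 0
  | m + 1, mu, lam => ∑ nu ∈ upSet mu, pathCount m nu lam

/-- The sequences of `m` box additions leading from `mu` to `lam`. -/
def BoxPath (m : ℕ) (mu lam : StrictPartition) : Type :=
  {t : Fin (m + 1) → StrictPartition // t 0 = mu ∧ t (Fin.last _) = lam ∧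
    ∀ i : Fin m, Covers (t i.castSucc) (t i.succ)}

/-- Prepend a box addition. -/
def BoxPath.cons (m : ℕ) (mu lam : StrictPartition) (p : Σ nu : upSet mu, BoxPath m nu lam) :
    BoxPath (m + 1) mu lam :=
  ⟨Fin.cons mu p.2.1, rfl, by
    rw [← Fin.succ_last, Fin.cons_succ]; exact p.2.2.2.1, fun i => by
    refine Fin.cases ?_ (fun j => ?_) i
    · rw [Fin.castSucc_zero, Fin.cons_zero, Fin.cons_succ, p.2.2.1]
      exact mem_upSet.1 p.1.2
    · rw [Fin.cons_succ, ← Fin.succ_castSucc, Fin.cons_succ]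
      exact p.2.2.2.2 j⟩

theorem BoxPath.cons_bijective (m : ℕ) (mu lam : StrictPartition) :
    Function.Bijective (BoxPath.cons m mu lam) := by
  constructor
  · rintro ⟨⟨nu, hnu⟩, ⟨s, h0, h1, h2⟩⟩ ⟨⟨nu', hnu'⟩, ⟨s', h0', h1', h2'⟩⟩ h
    have hs : s = s' := _root_.funext fun i => congrFun (congrArg Subtype.val h) i.succ
    subst hs
    have hn : nu = nu' := h0.symm.trans h0'
    subst hn
    rfl
  · rintro ⟨t, h0, h1, h2⟩
    refine ⟨⟨⟨t 1, mem_upSet.2 ?_⟩, ⟨Fin.tail t, rfl, ?_, fun i => ?_⟩⟩, ?_⟩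
    · have := h2 0
      rw [Fin.castSucc_zero, h0] at this
      exact this
    · exact h1
    · exact h2 i.succ
    · refine Subtype.ext ?_
      change Fin.cons mu (Fin.tail t) = t
      rw [← h0, Fin.cons_self_tail]

theorem finite_boxPath_and_card (m : ℕ) (mu lam : StrictPartition) :
    Finite (BoxPath m mu lam) ∧ Nat.card (BoxPath m mu lam) = pathCount m mu lam := by
  induction m generalizing mu with
  | zero =>
    have hsub : Subsingleton (BoxPath 0 mu lam) := by
      refine ⟨fun s t => Subtype.ext (_root_.funext fun i => ?_)⟩
      rw [Fin.eq_zero i, s.2.1, t.2.1]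
    refine ⟨inferInstance, ?_⟩
    rw [pathCount]
    split_ifs with h
    · have : Nonempty (BoxPath 0 mu lam) := ⟨⟨fun _ => mu, rfl, h, fun i => i.elim0⟩⟩
      exact Nat.card_of_subsingleton this.some
    · have : IsEmpty (BoxPath 0 mu lam) := ⟨fun t => h (t.2.1.symm.trans t.2.2.1)⟩
      exact Nat.card_of_isEmpty
  | succ m ih =>
    have hf : ∀ nu : upSet mu, Finite (BoxPath m nu lam) := fun nu => (ih nu).1
    have e := Equiv.ofBijective _ (BoxPath.cons_bijective m mu lam)
    refine ⟨Finite.of_equiv _ e, ?_⟩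
    rw [← Nat.card_congr e, Nat.card_sigma, pathCount]
    exact (Fintype.sum_congr _ _ fun nu : upSet mu => (ih nu.1).2).trans
      (Finset.sum_coe_sort (upSet mu) fun nu => pathCount m nu lam)

theorem numTableaux_eq_pathCount (lam : StrictPartition) :
    numTableaux lam = pathCount lam.size StrictPartition.empty lam :=
  (finite_boxPath_and_card lam.size StrictPartition.empty lam).2

/-- The recursion at the last step of a path instead of the first, which is what a removal of boxes
produces. -/
theorem pathCount_succ (m : ℕ) (mu lam : StrictPartition) :
    pathCount (m + 1) mu lam = ∑ nu ∈ downSet lam, pathCount m mu nu := by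
  classical
  induction m generalizing mu with
  | zero =>
    simp only [pathCount]
    rw [Finset.sum_ite_eq', Finset.sum_ite_eq]
    simp only [mem_upSet, mem_downSet]
  | succ m ih =>
    rw [pathCount, Finset.sum_congr rfl fun nu _ => ih nu, Finset.sum_comm]
    rfl

/-! ### The Pieri rule -/

theorem create_nsmul {ι A : Type*} [DecidableEq ι] [CommRing A] [Algebra ℚ A] (x : ι → A) (n : ℕ)
    (g : Polynomial ℚ) (F : Finset ι → A) : create x (n • g) F = n • create x g F := by
  rw [← Nat.cast_smul_eq_nsmul ℚ, create_smul, Nat.cast_smul_eq_nsmul]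

theorem create_apply_nsmul {ι A : Type*} [DecidableEq ι] [CommRing A] [Algebra ℚ A] (x : ι → A)
    (n : ℕ) (g : Polynomial ℚ) (F : Finset ι → A) : create x g (n • F) = n • create x g F := by
  rw [← Nat.cast_smul_eq_nsmul ℚ, create_apply_smul, Nat.cast_smul_eq_nsmul]

theorem create_apply_list_sum {ι A α : Type*} [DecidableEq ι] [CommRing A] [Algebra ℚ A]
    (x : ι → A) (g : Polynomial ℚ) (L : List α) (F : α → Finset ι → A) :
    create x g (L.map F).sum = (L.map fun a => create x g (F a)).sum := by
  induction L with
  | nil => exact create_apply_zero x g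
  | cons a L ih => rw [List.map_cons, List.sum_cons, create_apply_add, ih, List.map_cons, List.sum_cons]

/-- The Pieri rule for lists of exponents. -/
theorem setPsum_one_mul_createList {ι A : Type*} [DecidableEq ι] [CommRing A] [Algebra ℚ A]
    {x : ι → A} (hone : setPsum x 1 = createList x [Polynomial.X]) {φ : ℕ → Polynomial ℚ}
    (h1 : φ 1 = Polynomial.X) {t : ℕ}
    (hφ : ∀ k, Polynomial.X * φ k = φ (k + 1) + (t * k) • φ k) (l : List ℕ) :
    setPsum x 1 * createList x (l.map φ) =
      ((raise l).map fun b => createList x (b.map φ)).sum +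
        (t * l.sum) • createList x (l.map φ) := by
  induction l with
  | nil => simp [raise, hone, h1]
  | cons k l ih =>
    rw [List.map_cons, createList_cons, setPsum_mul_create, ih, pow_one, hφ, create_add,
      create_nsmul, create_apply_add, create_apply_nsmul, create_apply_list_sum, raise,
      List.map_cons, List.sum_cons, List.map_map, List.sum_cons, mul_add, add_smul]
    simp only [List.map_cons, createList_cons, Function.comp_def]
    abel

/-- The power sum `p_1` as an element of `Γ`. -/
def psumOne : Supersym := powerSumProd (OddPartition.ones 1)

theorem psumOne_apply (N : ℕ) : psumOne.1 N = ∑ i, X i := by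
  rw [psumOne, powerSumProd_apply]
  simp [OddPartition.ones, psum]

/-- The parameter `t` treats both families at once: `t = 0` for powers and `t = 1` for descending
powers. -/
theorem psumOne_mul_symmetrizationFun {φ : ℕ → Polynomial ℚ} (hφ : IsGraded φ (· ≤ ·)) {t : ℕ}
    (ht : ∀ k, Polynomial.X * φ k = φ (k + 1) + (t * k) • φ k) (mu : StrictPartition) :
    psumOne * symmetrizationFun φ mu =
      ∑ nu ∈ upSet mu, symmetrizationFun φ nu + (t * mu.size) • symmetrizationFun φ mu := by
  refine toFraction_injective RationalFn (_root_.funext fun N => ?_)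
  rw [map_add, map_sum, map_nsmul, Pi.add_apply, Finset.sum_apply, Pi.smul_apply]
  have e1 : toFraction RationalFn (psumOne * symmetrizationFun φ mu) N =
      algebraMap (MvPolynomial (Fin N) ℚ) (RationalFn N) (psumOne.1 N) *
      algebraMap (MvPolynomial (Fin N) ℚ) (RationalFn N) ((symmetrizationFun φ mu).1 N) :=
    (algebraMap (MvPolynomial (Fin N) ℚ) (RationalFn N)).map_mul _ _
  have e2 : ∀ lam, toFraction RationalFn (symmetrizationFun φ lam) N =
      createList (fractionVar RationalFn N) (lam.parts.map φ) Finset.univ := fun lam =>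
    congrFun (toFraction_symmetrizationFun hφ lam) N
  have e3 : algebraMap (MvPolynomial (Fin N) ℚ) (RationalFn N) (psumOne.1 N) =
      setPsum (fractionVar RationalFn N) 1 Finset.univ := by
    simp [psumOne_apply, setPsum, fractionVar]
  have hone := setPsum_eq_create (fractionVar RationalFn N) (fractionVar_injective N)
    (fractionVar_add_ne_zero N) (r := 1) odd_one
  simp only [pow_one, Nat.sub_self, Finset.range_zero, Finset.sum_empty, add_zero] at hone
  have key := congrFun (setPsum_one_mul_createList hone hφ.one ht mu.parts) Finset.univ
  rw [sum_map_raise mu (f := fun b => createList (fractionVar RationalFn N) (b.map φ))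
    (fun b h h' => createList_eq_zero_of_not_strict _ φ h h')] at key
  rw [Pi.mul_apply, Pi.add_apply, Finset.sum_apply, Pi.smul_apply] at key
  rw [e1, e3, Finset.sum_congr rfl fun nu _ => e2 nu, e2 mu]
  exact (congrArg _ (e2 mu)).trans key

theorem psumOne_mul_schurP (mu : StrictPartition) :
    psumOne * schurP mu = ∑ nu ∈ upSet mu, schurP nu := by
  have h := psumOne_mul_symmetrizationFun isGraded_pow.of_eq (t := 0)
    (fun k => by rw [zero_mul, zero_smul, add_zero, pow_succ']) mu
  rwa [zero_mul, zero_smul, add_zero] at h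

theorem psumOne_mul_factorialSchurP (mu : StrictPartition) :
    psumOne * factorialSchurP mu =
      ∑ nu ∈ upSet mu, factorialSchurP nu + mu.size • factorialSchurP mu := by
  have h := psumOne_mul_symmetrizationFun isGraded_descPochhammer (t := 1)
    (fun k => by rw [one_mul, X_mul_descPochhammer, Nat.cast_smul_eq_nsmul]) mu
  rwa [one_mul] at h

theorem psumOne_pow_mul_schurP (m : ℕ) (mu : StrictPartition) :
    psumOne ^ m * schurP mu =
      ∑ lam ∈ strictPartitionsOf (mu.size + m), pathCount m mu lam • schurP lam := by
  classical
  induction m generalizing mu with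
  | zero =>
    rw [pow_zero, one_mul, Finset.sum_eq_single mu]
    · simp [pathCount]
    · intro lam _ hne
      simp [pathCount, Ne.symm hne]
    · intro h
      exact absurd (mem_strictPartitionsOf.2 rfl) h
  | succ m ih =>
    rw [pow_succ, mul_assoc, psumOne_mul_schurP, Finset.mul_sum]
    have : ∀ nu ∈ upSet mu, psumOne ^ m * schurP nu =
        ∑ lam ∈ strictPartitionsOf (mu.size + (m + 1)), pathCount m nu lam • schurP lam := by
      intro nu hnu
      rw [ih nu, (mem_upSet.1 hnu).size_eq, add_right_comm, add_assoc]
    rw [Finset.sum_congr rfl this, Finset.sum_comm]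
    refine Finset.sum_congr rfl fun lam _ => ?_
    rw [← Finset.sum_smul]
    rfl

/-! ### Values of factorial Schur `P`-functions -/

/-- The value of a supersymmetric function at a strict partition, as an algebra homomorphism. -/
def evalHom (lam : StrictPartition) : Supersym →ₐ[ℚ] ℚ :=
  ((aeval fun i : Fin lam.length => (lam.part i : ℚ)).comp
    (Pi.evalAlgHom ℚ (fun N => MvPolynomial (Fin N) ℚ) lam.length)).comp Supersym.val

theorem evalHom_apply (f : Supersym) (lam : StrictPartition) : evalHom lam f = evalAt f lam :=
  RingHom.congr_fun (coe_aeval_eq_eval _) (f.1 lam.length)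

theorem StrictPartition.part_eq_getElem (lam : StrictPartition) (i : Fin lam.length) :
    lam.part i = lam.parts[(i : ℕ)]'i.2 := List.getD_eq_getElem _ _ _

theorem StrictPartition.part_injective (lam : StrictPartition) :
    Function.Injective fun i : Fin lam.length => lam.part i := by
  intro i j h
  simp only [lam.part_eq_getElem] at h
  have hn : lam.parts.Nodup := lam.sorted.imp fun h => ne_of_gt h
  exact Fin.ext ((hn.getElem_inj_iff).1 h)

theorem StrictPartition.part_pos (lam : StrictPartition) (i : Fin lam.length) :
    0 < lam.part i := by
  rw [lam.part_eq_getElem]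
  exact lam.pos _ (List.getElem_mem _)

theorem StrictPartition.map_part (lam : StrictPartition) :
    (Finset.univ : Finset (Fin lam.length)).val.map (fun i : Fin lam.length => lam.part i) =
      (lam.parts : Multiset ℕ) := by
  rw [Fin.univ_val_map]
  congr 1
  conv_rhs => rw [← List.ofFn_getElem (xs := lam.parts)]
  exact congrArg List.ofFn (_root_.funext fun i => lam.part_eq_getElem i)

theorem StrictPartition.sum_part (lam : StrictPartition) :
    ∑ i : Fin lam.length, lam.part i = lam.size := by
  rw [Finset.sum, lam.map_part]
  rfl

theorem evalHom_factorialSchurP (mu lam : StrictPartition) :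
    evalHom lam (factorialSchurP mu) = createList (fun i : Fin lam.length => (lam.part i : ℚ))
      (mu.parts.map fun k => descPochhammer ℚ k) Finset.univ :=
  aeval_eq_createList (symmetrizationFun_spec isGraded_descPochhammer mu lam.length) _
    fun _ _ hij => (sub_ne_zero.2 fun h => hij (lam.part_injective (Nat.cast_injective h))).isUnit

/-- The vanishing property of the factorial Schur `P`-functions. -/
theorem vanishing_createList {ι : Type*} [DecidableEq ι] (a : ι → ℕ) (ha : ∀ i, 0 < a i)
    (l : List ℕ) : ∀ S : Finset ι,
    createList (fun i => (a i : ℚ)) (l.map fun k => descPochhammer ℚ k) S ≠ 0 →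
    l.sum ≤ ∑ i ∈ S, a i ∧ (l.sum = ∑ i ∈ S, a i → (l : Multiset ℕ) = S.val.map a) := by
  induction l with
  | nil =>
    intro S _
    refine ⟨by simp, fun h => ?_⟩
    have hS : S = ∅ := by
      refine Finset.eq_empty_of_forall_notMem fun i hi => ?_
      have h0 : ∑ i ∈ S, a i = 0 := h.symm
      exact (ha i).ne' (Finset.sum_eq_zero_iff.1 h0 i hi)
    rw [hS]
    rfl
  | cons k l ih =>
    intro S h
    rw [List.map_cons, createList_cons, create] at h
    obtain ⟨i, hi, h0⟩ := Finset.exists_ne_zero_of_sum_ne_zero h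
    have h1 := left_ne_zero_of_mul (left_ne_zero_of_mul h0)
    obtain ⟨h2, h3⟩ := ih (S.erase i) (right_ne_zero_of_mul h0)
    -- A nonzero summand needs `(a_i)^{↓k} ≠ 0`. Thus each exponent is matched with its own
    -- coordinate of at least that size, and equal sums force equality throughout.
    have hk : k ≤ a i := by
      by_contra hlt
      refine h1 ?_
      rw [Polynomial.coe_aeval_eq_eval, descPochhammer_eval_eq_descFactorial,
        Nat.descFactorial_of_lt (not_le.1 hlt), Nat.cast_zero]
    have hsum := Finset.add_sum_erase S a hi
    rw [List.sum_cons]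
    refine ⟨by omega, fun heq => ?_⟩
    have hk' : k = a i := by omega
    rw [← Multiset.cons_coe, h3 (by omega), hk', ← Multiset.map_cons a, Finset.erase_val,
      Multiset.cons_erase hi]

theorem evalHom_factorialSchurP_eq_zero {mu lam : StrictPartition} (h : lam.size ≤ mu.size)
    (hne : mu ≠ lam) : evalHom lam (factorialSchurP mu) = 0 := by
  by_contra h0
  rw [evalHom_factorialSchurP] at h0
  obtain ⟨h1, h2⟩ := vanishing_createList (fun i : Fin lam.length => lam.part i) lam.part_pos
    mu.parts Finset.univ h0
  rw [lam.sum_part] at h1 h2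
  have h3 := h2 (le_antisymm h1 h)
  rw [lam.map_part] at h3
  exact hne (StrictPartition.parts_perm_inj (Multiset.coe_eq_coe.1 h3))

theorem evalHom_psumOne (lam : StrictPartition) : evalHom lam psumOne = lam.size := by
  rw [← lam.sum_part]
  change aeval _ (psumOne.1 lam.length) = _
  rw [psumOne_apply, map_sum]
  simp

/-- Evaluating the factorial Pieri rule at `lam`, where `p_1` takes the value `|lam|`, gives `(|lam|
- |mu|) P*_mu(lam) = ∑ P*_nu(lam)`. The induction ends at size `|lam|`, where only `lam` itself
survives by the vanishing property. -/
theorem factorial_mul_evalHom (m : ℕ) (mu lam : StrictPartition) (h : lam.size = mu.size + m) :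
    (m.factorial : ℚ) * evalHom lam (factorialSchurP mu) =
      pathCount m mu lam * evalHom lam (factorialSchurP lam) := by
  induction m generalizing mu with
  | zero =>
    rw [pathCount]
    split_ifs with hml
    · rw [hml, Nat.factorial_zero]
    · rw [evalHom_factorialSchurP_eq_zero h.le hml]
      simp
  | succ m ih =>
    have hp := congrArg (evalHom lam) (psumOne_mul_factorialSchurP mu)
    rw [map_mul, map_add, map_sum, map_nsmul, evalHom_psumOne, h, nsmul_eq_mul] at hp
    push_cast at hp
    have hp' : ((m : ℚ) + 1) * evalHom lam (factorialSchurP mu) =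
        ∑ nu ∈ upSet mu, evalHom lam (factorialSchurP nu) := by linear_combination hp
    rw [Nat.factorial_succ, pathCount]
    push_cast
    rw [mul_comm ((m : ℚ) + 1), mul_assoc, hp', Finset.mul_sum, Finset.sum_mul]
    refine Finset.sum_congr rfl fun nu hnu => ih nu ?_
    rw [h, (mem_upSet.1 hnu).size_eq]
    omega

theorem numTableaux_mul_evalHom (lam : StrictPartition) :
    (numTableaux lam : ℚ) * evalHom lam (factorialSchurP lam) = lam.size.factorial := by
  rw [numTableaux_eq_pathCount, ← factorial_mul_evalHom lam.size StrictPartition.empty lam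
    (Nat.zero_add _).symm, evalHom_factorialSchurP]
  simp [StrictPartition.empty]

/-! ### The exponential specialization -/

open Classical in
/-- The linear functional `Γ → ℚ` with `p_rho ↦ 1` if all parts of `rho` are `1` and
`p_rho ↦ 0` otherwise. -/
def expSpec : Supersym →ₗ[ℚ] ℚ :=
  powerSumBasis.constr ℚ fun rho => if ∀ i ∈ rho.parts, i = 1 then 1 else 0

open Classical in
theorem expSpec_powerSumProd (rho : OddPartition) :
    expSpec (powerSumProd rho) = if ∀ i ∈ rho.parts, i = 1 then 1 else 0 := by
  rw [← powerSumBasis_apply, expSpec, Module.Basis.constr_basis]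

/-- The odd power sum as an element of `Γ`. -/
def psumOdd (r : ℕ) (hr : Odd r) : Supersym :=
  ⟨powerSum r, Algebra.subset_adjoin ⟨r, hr, rfl⟩⟩

theorem psumOdd_mul_powerSumProd {r : ℕ} (hr : Odd r) (rho : OddPartition) :
    psumOdd r hr * powerSumProd rho = powerSumProd (OddPartition.ofList (r :: rho.parts)
      (by simpa using ⟨hr, rho.odd⟩)) := by
  refine Subtype.ext ?_
  rw [powerSumProd_ofList, List.map_cons, List.prod_cons]
  rfl

/-- The only part of the multiplicativity of `expSpec` that is used. -/
theorem expSpec_psumOdd_mul {r : ℕ} (hr : Odd r) (f : Supersym) :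
    expSpec (psumOdd r hr * f) = if r = 1 then expSpec f else 0 := by
  classical
  have h : f ∈ Submodule.span ℚ (Set.range powerSumProd) := by
    rw [span_powerSumProd]; exact Submodule.mem_top
  induction h using Submodule.span_induction with
  | mem f hf =>
    obtain ⟨rho, rfl⟩ := hf
    rw [psumOdd_mul_powerSumProd, expSpec_powerSumProd, expSpec_powerSumProd, ← ite_and]
    refine if_congr ?_ rfl rfl
    have : ∀ i, i ∈ (OddPartition.ofList (r :: rho.parts)
        (by simpa using ⟨hr, rho.odd⟩)).parts ↔ i ∈ r :: rho.parts := fun i =>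
      (List.perm_insertionSort _ _).mem_iff
    simp only [this, List.mem_cons, forall_eq_or_imp]
  | zero => simp
  | add f g _ _ h1 h2 => rw [mul_add, map_add, h1, h2, map_add]; split_ifs <;> simp
  | smul a f _ h => rw [mul_smul_comm, map_smul, h, map_smul]; split_ifs <;> simp

theorem psumOne_eq : psumOne = psumOdd 1 odd_one := by
  refine Subtype.ext ?_
  change ((OddPartition.ones 1).parts.map powerSum).prod = powerSum 1
  simp [OddPartition.ones]

theorem expSpec_psumOne_pow_mul (m : ℕ) (f : Supersym) :
    expSpec (psumOne ^ m * f) = expSpec f := by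
  induction m with
  | zero => rw [pow_zero, one_mul]
  | succ m ih => rw [pow_succ', mul_assoc, psumOne_eq, expSpec_psumOdd_mul, if_pos rfl,
      ← psumOne_eq, ih]

/-! ### An infinitesimal variable -/

section Dual

open TrivSqZeroExt DualNumber

variable {K : ℕ → Type} [∀ N, Field (K N)] [∀ N, CharZero (K N)] (x : ∀ N, Fin N → K N)

/-- The points `x_1, …, x_N, ε` in the dual numbers. -/
def dualPoint (N : ℕ) : Fin (N + 1) → DualNumber (K N) :=
  Fin.snoc (α := fun _ => DualNumber (K N)) (fun i => inl (x N i)) ε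

/-- Since `ε² = 0`, among the `p_r` with `r ≥ 1` only `p_1` notices the new variable. So the
`ε`-coefficient realizes differentiation by `p_1`. -/
theorem dual_powerSum (r : ℕ) (N : ℕ) : aeval (dualPoint x N) (powerSum r (N + 1)) =
    inl (aeval (x N) (powerSum r N)) + inr (if r = 1 then 1 else 0) + if r = 0 then 1 else 0 := by
  have h1 : ∀ S : Finset (Fin N), ∑ i ∈ S, (inl (x N i) : DualNumber (K N)) ^ r =
      inl (∑ i ∈ S, x N i ^ r) := by
    intro S
    induction S using Finset.induction_on with
    | empty => simp
    | insert i T hi ih =>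
      rw [Finset.sum_insert hi, Finset.sum_insert hi, ih, inl_add, inl_pow]
  have h2 : (ε : DualNumber (K N)) ^ r =
      inr (if r = 1 then 1 else 0) + if r = 0 then 1 else 0 := by
    obtain _ | _ | r := r
    · simp
    · simp
    · rw [pow_succ, pow_succ, mul_assoc, DualNumber.eps_mul_eps]
      simp
  simp only [powerSum, psum, map_sum, map_pow, aeval_X]
  rw [Fin.sum_univ_castSucc]
  simp only [dualPoint, Fin.snoc_castSucc, Fin.snoc_last]
  rw [h1, h2, add_assoc]

/-- The witness `g` is the derivative of `f` by `p_1`, built by the Leibniz rule. Under `expSpec` it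
acts as the degree: on `p_1^r` it gives the factor `r`, and any product containing another `p_s`
goes to `0` on both sides. -/
theorem exists_dual_of_list {l : List ℕ} (hl : ∀ i ∈ l, Odd i) :
    ∃ f g : Supersym, f.1 = (l.map powerSum).prod ∧ expSpec g = l.sum * expSpec f ∧ ∀ N,
      aeval (dualPoint x N) (f.1 (N + 1)) =
        inl (aeval (x N) (f.1 N)) + inr (aeval (x N) (g.1 N)) := by
  induction l with
  | nil => exact ⟨1, 0, rfl, by simp, fun N => by simp⟩
  | cons r l ih =>
    obtain ⟨f, g, h1, h2, h3⟩ := ih fun i hi => hl i (List.mem_cons_of_mem _ hi)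
    have hr : Odd r := hl r (by simp)
    have hr0 : r ≠ 0 := hr.pos.ne'
    refine ⟨psumOdd r hr * f, psumOdd r hr * g + if r = 1 then f else 0, ?_, ?_, fun N => ?_⟩
    · rw [List.map_cons, List.prod_cons, ← h1]
      rfl
    · rw [map_add, expSpec_psumOdd_mul, expSpec_psumOdd_mul, List.sum_cons]
      split_ifs with h
      · rw [h2, h]; push_cast; ring
      · simp
    · have e1 : ∀ (f : Supersym) M, (psumOdd r hr * f).1 M = powerSum r M * f.1 M :=
        fun _ _ => rfl
      have e2 : (psumOdd r hr * g + if r = 1 then f else 0 : Supersym).1 N =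
          powerSum r N * g.1 N + if r = 1 then f.1 N else 0 := by
        split_ifs <;> rfl
      rw [e1, e1, e2, map_mul, h3, dual_powerSum, if_neg hr0, map_mul, map_add, map_mul]
      split_ifs <;> ext <;> simp [mul_comm]

theorem dual_powerSumProd (rho : OddPartition) :
    ∃ g : Supersym, expSpec g = rho.size * expSpec (powerSumProd rho) ∧ ∀ N,
      aeval (dualPoint x N) ((powerSumProd rho).1 (N + 1)) =
        inl (aeval (x N) ((powerSumProd rho).1 N)) + inr (aeval (x N) (g.1 N)) := by
  obtain ⟨f, g, h1, h2, h3⟩ := exists_dual_of_list x rho.odd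
  have hf : f = powerSumProd rho := Subtype.ext h1
  subst hf
  exact ⟨g, h2, h3⟩

/-- The expansion of the values of a homogeneous supersymmetric function to first order in an
additional variable. -/
theorem dual_of_mem_span {k : ℕ} {f : Supersym}
    (hf : f ∈ Submodule.span ℚ (powerSumProd '' {rho | rho.size = k})) :
    ∃ g : Supersym, expSpec g = k * expSpec f ∧ ∀ N,
      aeval (dualPoint x N) (f.1 (N + 1)) =
        inl (aeval (x N) (f.1 N)) + inr (aeval (x N) (g.1 N)) := by
  induction hf using Submodule.span_induction with
  | mem f hf =>
    obtain ⟨rho, rfl, rfl⟩ := hf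
    exact dual_powerSumProd x rho
  | zero => exact ⟨0, by simp, fun N => by simp⟩
  | add f f' _ _ h h' =>
    obtain ⟨g, h1, h2⟩ := h
    obtain ⟨g', h1', h2'⟩ := h'
    refine ⟨g + g', by rw [map_add, map_add, h1, h1', mul_add], fun N => ?_⟩
    have e : ∀ (f f' : Supersym) N, (f + f').1 N = f.1 N + f'.1 N := fun _ _ _ => rfl
    rw [e, e, e, map_add, map_add, map_add, h2, h2', inl_add, inr_add]
    abel
  | smul a f _ h =>
    obtain ⟨g, h1, h2⟩ := h
    refine ⟨a • g, by rw [map_smul, map_smul, h1, smul_eq_mul, smul_eq_mul, mul_left_comm],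
      fun N => ?_⟩
    have e : ∀ (f : Supersym) N, (a • f).1 N = a • f.1 N := fun _ _ => rfl
    rw [e, e, e, map_smul, map_smul, map_smul, h2, smul_add, inl_smul, inr_smul]

end Dual

/-! ### Creation operators with one infinitesimal variable -/

section DualCreate

set_option linter.unusedSectionVars false

open TrivSqZeroExt DualNumber

variable {ι K : Type} [DecidableEq ι] [Field K] [CharZero K] (x : ι → K)

/-- The points `x_i` together with `ε`. -/
def dualOption : Option ι → DualNumber K := fun i => i.elim ε fun i => inl (x i)

theorem dual_isUnit {z : DualNumber K} (h : z.fst ≠ 0) : IsUnit z :=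
  TrivSqZeroExt.isUnit_iff_isUnit_fst.2 h.isUnit

/-- This is `(x + ε)/(x - ε) = 1 + 2ε/x` in the dual numbers; the `2` is the source of the powers of
two in the Plancherel weight. -/
theorem crossFactor_some_none (hx0 : ∀ i, x i ≠ 0) (i : ι) :
    crossFactor (dualOption x) (some i) none = inl 1 + inr (2 / x i) := by
  have hu : IsUnit (inl (x i) - ε : DualNumber K) := dual_isUnit (by simpa using hx0 i)
  have h : (inl (x i) + ε : DualNumber K) = (inl 1 + inr (2 / x i)) * (inl (x i) - ε) := by
    have := hx0 i
    ext
    · simp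
    · simp
      field_simp
      ring
  rw [crossFactor]
  change (inl (x i) + ε : DualNumber K) * Ring.inverse (inl (x i) - ε) = _
  rw [h, mul_assoc, Ring.mul_inverse_cancel _ hu, mul_one]

theorem eps_mul (z : DualNumber K) : (ε : DualNumber K) * z = inr z.fst := by
  ext <;> simp

/-- Only the constant term matters, because this product will be multiplied by `ε`; there each
factor `(ε + x)/(ε - x)` reduces to `-1`. -/
theorem fst_crossProd_none (hx0 : ∀ i, x i ≠ 0) (S : Finset ι) :
    (crossProd (dualOption x) none (S.map Function.Embedding.some)).fst = (-1) ^ S.card := by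
  rw [crossProd, Finset.prod_map]
  have : ∀ T : Finset ι, (∏ i ∈ T, crossFactor (dualOption x) none
      (Function.Embedding.some i)).fst = (-1) ^ T.card := by
    intro T
    induction T using Finset.induction_on with
    | empty => simp
    | insert i T hi ih =>
      rw [Finset.prod_insert hi, fst_mul, ih, Finset.card_insert_of_notMem hi]
      change (crossFactor (dualOption x) none (some i)).fst * _ = _
      rw [crossFactor_swap _ (some i) none, crossFactor_some_none x hx0]
      simp [pow_succ]
  exact this S

theorem crossFactor_some_some (hx : Function.Injective x) {i j : ι} (hij : i ≠ j) :
    crossFactor (dualOption x) (some i) (some j) = inl (crossFactor x i j) := by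
  have hu : IsUnit (x i - x j) := (sub_ne_zero.2 (hx.ne hij)).isUnit
  have hu' : IsUnit (inl (x i) - inl (x j) : DualNumber K) :=
    dual_isUnit (by simpa using sub_ne_zero.2 (hx.ne hij))
  change (inl (x i) + inl (x j) : DualNumber K) * Ring.inverse (inl (x i) - inl (x j)) = _
  have : (inl (x i) + inl (x j) : DualNumber K) =
      inl (crossFactor x i j) * (inl (x i) - inl (x j)) := by
    rw [← inl_add, ← inl_sub, ← inl_mul, crossFactor, mul_assoc, Ring.inverse_mul_cancel _ hu,
      mul_one]
  rw [this, mul_assoc, Ring.mul_inverse_cancel _ hu', mul_one]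

theorem crossProd_some_map (hx : Function.Injective x) (i : ι) {S : Finset ι} (hi : i ∉ S) :
    crossProd (dualOption x) (some i) (S.map Function.Embedding.some) = inl (crossProd x i S) := by
  rw [crossProd, Finset.prod_map, crossProd]
  have : ∀ T ⊆ S, ∏ j ∈ T, crossFactor (dualOption x) (some i) (Function.Embedding.some j) =
      inl (∏ j ∈ T, crossFactor x i j) := by
    intro T
    induction T using Finset.induction_on with
    | empty => intro _; simp
    | insert j T hj ih =>
      intro hT
      rw [Finset.prod_insert hj, Finset.prod_insert hj,
        ih fun k hk => hT (Finset.mem_insert_of_mem hk), inl_mul]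
      congr 1
      exact crossFactor_some_some x hx fun h => hi (h ▸ hT (Finset.mem_insert_self j T))
  exact this S subset_rfl

theorem erase_insertNone_none (S : Finset ι) :
    (Finset.insertNone S).erase none = S.map Function.Embedding.some := by
  ext (_ | i) <;> simp

theorem erase_insertNone_some (S : Finset ι) (i : ι) :
    (Finset.insertNone S).erase (some i) = Finset.insertNone (S.erase i) := by
  ext (_ | j) <;> simp

theorem insertNone_eq (S : Finset ι) :
    Finset.insertNone S = insert none (S.map Function.Embedding.some) := by
  ext (_ | i) <;> simp

theorem createList_map_some (hx : Function.Injective x) (fs : List (Polynomial ℚ))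
    (S : Finset ι) : createList (dualOption x) fs (S.map Function.Embedding.some) =
      inl (createList x fs S) :=
  (map_createList (inlAlgHom ℚ K K) x (dualOption x) Function.Embedding.some (fun _ => rfl)
    (fun _ _ h => (sub_ne_zero.2 (hx.ne h)).isUnit) fs S).symm

/-- The first order expansion of a creation operator in an additional variable. -/
theorem create_insertNone (hx : Function.Injective x) (hx0 : ∀ i, x i ≠ 0) (k : ℕ)
    {F : Finset (Option ι) → DualNumber K} {f g : Finset ι → K}
    (hF : ∀ S, F (Finset.insertNone S) = inl (f S) + inr (g S)) {S : Finset ι}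
    (hF' : F (S.map Function.Embedding.some) = inl (f S)) :
    create (dualOption x) (Polynomial.X ^ (k + 1)) F (Finset.insertNone S) =
      inl (create x (Polynomial.X ^ (k + 1)) f S) +
      inr (create x (Polynomial.X ^ (k + 1)) g S + 2 * create x (Polynomial.X ^ k) f S +
        if k = 0 then (-1) ^ S.card * f S else 0) := by
  rw [create, insertNone_eq, Finset.sum_insert (by simp), ← insertNone_eq, Finset.sum_map,
    erase_insertNone_none, hF']
  -- The term in which the new index is the created one carries `ε^{k+1}`, so it survives only for
  -- `k = 0`.
  have h1 : Polynomial.aeval (dualOption x none) (Polynomial.X ^ (k + 1) : Polynomial ℚ) *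
      crossProd (dualOption x) none (S.map Function.Embedding.some) * inl (f S) =
      inr (if k = 0 then (-1) ^ S.card * f S else 0) := by
    rw [map_pow, Polynomial.aeval_X]
    change (ε : DualNumber K) ^ (k + 1) * _ * _ = _
    obtain _ | k := k
    · rw [zero_add, pow_one, eps_mul, fst_crossProd_none x hx0, if_pos rfl, inr_mul_inl]
      simp [mul_comm]
    · rw [pow_succ, pow_succ, mul_assoc (ε ^ k), DualNumber.eps_mul_eps, mul_zero, zero_mul, zero_mul,
        if_neg (Nat.succ_ne_zero k), inr_zero]
  -- For an old index the cross factor with the new variable is `1 + 2ε/x_i`, whose second part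
  -- lowers `x_i^{k+1}` to `2 x_i^k`.
  have h2 : ∀ i ∈ S, Polynomial.aeval (dualOption x (Function.Embedding.some i))
      (Polynomial.X ^ (k + 1) : Polynomial ℚ) *
      crossProd (dualOption x) (Function.Embedding.some i)
        ((Finset.insertNone S).erase (Function.Embedding.some i)) *
      F ((Finset.insertNone S).erase (Function.Embedding.some i)) =
      inl (Polynomial.aeval (x i) (Polynomial.X ^ (k + 1) : Polynomial ℚ) *
        crossProd x i (S.erase i) * f (S.erase i)) +
      inr (Polynomial.aeval (x i) (Polynomial.X ^ (k + 1) : Polynomial ℚ) *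
        crossProd x i (S.erase i) * g (S.erase i) +
        2 * (Polynomial.aeval (x i) (Polynomial.X ^ k : Polynomial ℚ) *
        crossProd x i (S.erase i) * f (S.erase i))) := by
    intro i _
    change Polynomial.aeval (inl (x i) : DualNumber K) (Polynomial.X ^ (k + 1) : Polynomial ℚ) *
      crossProd (dualOption x) (some i) ((Finset.insertNone S).erase (some i)) *
      F ((Finset.insertNone S).erase (some i)) = _
    rw [erase_insertNone_some, hF, insertNone_eq, crossProd, Finset.prod_insert (by simp),
      ← crossProd, crossProd_some_map x hx i (Finset.notMem_erase i S),
      crossFactor_some_none x hx0]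
    simp only [map_pow, Polynomial.aeval_X]
    have := hx0 i
    ext
    · simp
    · simp
      field_simp
      ring
  rw [h1, Finset.sum_congr rfl h2, Finset.sum_add_distrib, create, create, create]
  generalize (if k = 0 then (-1) ^ S.card * f S else 0) = c
  ext
  · simp [fst_sum]
  · simp [snd_sum, Finset.sum_add_distrib, Finset.mul_sum]
    ring

/-- The weights of the lists with a box removed. -/
def lowerWeight (a b : List ℕ) : ℕ := if b.length = a.length then 2 else 1

theorem createList_insertNone (hx : Function.Injective x) (hx0 : ∀ i, x i ≠ 0) {l : List ℕ}
    (hl : ∀ i ∈ l, 0 < i) (hs : l.Pairwise (· > ·)) (S : Finset ι) :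
    createList (dualOption x) (l.map fun k => Polynomial.X ^ k) (Finset.insertNone S) =
      inl (createList x (l.map fun k => Polynomial.X ^ k) S) +
      inr (((lower l).map fun b => lowerWeight l b •
        createList x (b.map fun k => Polynomial.X ^ k)).sum S) := by
  induction l generalizing S with
  | nil => simp [lower]
  | cons k l ih =>
    have hk := hl k (by simp)
    rw [List.pairwise_cons] at hs
    have hl' : ∀ i ∈ l, 0 < i := fun i hi => hl i (by simp [hi])
    obtain ⟨k, rfl⟩ : ∃ m, k = m + 1 := ⟨k - 1, (Nat.sub_add_cancel hk).symm⟩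
    rw [List.map_cons, createList_cons, create_insertNone x hx hx0 k (ih hl' hs.2)
      (createList_map_some x hx _ S), createList_cons]
    congr 2
    rw [lower, List.map_cons, List.sum_cons, List.map_map, Pi.add_apply]
    have hmap : ((lower l).map ((fun b => lowerWeight ((k + 1) :: l) b •
        createList x (b.map fun k => Polynomial.X ^ k)) ∘ fun b => (k + 1) :: b)).sum =
        create x (Polynomial.X ^ (k + 1)) ((lower l).map fun b => lowerWeight l b •
          createList x (b.map fun k => Polynomial.X ^ k)).sum := by
      rw [create_apply_list_sum]
      congr 2
      funext b
      simp only [Function.comp_apply, List.map_cons, createList_cons, create_apply_nsmul]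
      congr 1
      simp [lowerWeight]
    rw [hmap]
    obtain _ | k := k
    · have hnil : l = [] := by
        refine List.eq_nil_iff_forall_not_mem.2 fun i hi => ?_
        have := hs.1 i hi
        have := hl' i hi
        omega
      subst hnil
      -- The part is `1`, necessarily the last one. Partial fractions at `z = 0` give `(-1)^{|S|} +
      -- 2 ∑ crossProd = 1`, so removing this part has weight `1`, not `2`.
      have hp := prod_add_div_sub S x hx.injOn 0 fun i _ h => hx0 i h.symm
      have h1 : ∀ i ∈ S, (0 + x i) / (0 - x i) = -1 := fun i _ => by
        rw [zero_add, zero_sub, div_neg, div_self (hx0 i)]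
      have h2 : ∀ i ∈ S, 2 * x i / (0 - x i) * crossProd x i (S.erase i) =
          -2 * crossProd x i (S.erase i) := fun i _ => by
        rw [zero_sub, div_neg, mul_div_assoc, div_self (hx0 i)]; ring
      rw [Finset.prod_congr rfl h1, Finset.sum_congr rfl h2, Finset.prod_const,
        ← Finset.mul_sum] at hp
      simp only [lower, List.map_nil, List.sum_nil, if_pos, createList_nil, lowerWeight, create]
      simp [hp]
    · rw [if_neg (Nat.succ_ne_zero k), if_neg (by omega), lowerWeight, if_pos (by simp)]
      simp only [Nat.add_sub_cancel, List.map_cons, createList_cons, Pi.smul_apply, nsmul_eq_mul]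
      push_cast
      ring

end DualCreate

/-! ### The exponential specialization of Schur `P`-functions -/

theorem aeval_schurP {N : ℕ} {A : Type*} [CommRing A] [Algebra ℚ A] (lam : StrictPartition)
    (y : Fin N → A) (hy : ∀ i j, i ≠ j → IsUnit (y i - y j)) :
    aeval y ((schurP lam).1 N) =
      createList y (lam.parts.map fun k => Polynomial.X ^ k) Finset.univ :=
  aeval_eq_createList (symmetrizationFun_spec isGraded_pow.of_eq lam N) y hy

section

set_option linter.unusedSectionVars false

open TrivSqZeroExt DualNumber

variable {K : ℕ → Type} [∀ N, Field (K N)] [∀ N, CharZero (K N)] {x : ∀ N, Fin N → K N}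

/-- The `ε`-coefficient of `P_lam(x, ε)`, that is, the removal of a box from `lam`; ties created by
lowering an entry drop out. -/
theorem dual_schurP (hx : ∀ N, Function.Injective (x N)) (hx0 : ∀ N i, x N i ≠ 0)
    (lam : StrictPartition) (N : ℕ) : (aeval (dualPoint x N) ((schurP lam).1 (N + 1))).snd =
      ∑ mu ∈ downSet lam, lowerWeight lam.parts mu.parts • aeval (x N) ((schurP mu).1 N) := by
  have hsucc : ∀ i : Fin (N + 1), dualPoint x N i = dualOption (x N) (finSuccEquivLast i) := by
    intro i
    refine Fin.lastCases ?_ (fun i => ?_) i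
    · simp [dualPoint, dualOption]
    · simp [dualPoint, dualOption]
  have hunit : ∀ i j, i ≠ j → IsUnit (dualPoint x N i - dualPoint x N j) := by
    intro i j hij
    refine dual_isUnit ?_
    rw [hsucc, hsucc, fst_sub, sub_ne_zero]
    have h := (finSuccEquivLast (n := N)).injective.ne hij
    generalize finSuccEquivLast i = a at h
    generalize finSuccEquivLast j = b at h
    cases a <;> cases b
    · exact absurd rfl h
    · simpa [dualOption] using (hx0 N _).symm
    · simpa [dualOption] using hx0 N _
    · simpa [dualOption] using fun e => h (congrArg some (hx N e))
  have hm := map_createList (AlgHom.id ℚ (DualNumber (K N))) (dualPoint x N) (dualOption (x N))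
    finSuccEquivLast.toEmbedding (fun i => (hsucc i).symm) hunit
    (lam.parts.map fun k => Polynomial.X ^ k) Finset.univ
  have huniv : (Finset.univ : Finset (Fin (N + 1))).map finSuccEquivLast.toEmbedding =
      Finset.insertNone Finset.univ := by
    rw [Finset.map_univ_equiv]
    ext (_ | i) <;> simp
  rw [AlgHom.id_apply, huniv, createList_insertNone (x N) (hx N) (hx0 N) lam.pos lam.sorted] at hm
  rw [aeval_schurP lam _ hunit, hm, snd_add, snd_inl, snd_inr, zero_add, sum_map_lower lam
    (f := fun b => lowerWeight lam.parts b • createList (x N) (b.map fun k => Polynomial.X ^ k))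
    (fun b h h' => by rw [createList_eq_zero_of_not_strict _ _ h h', smul_zero]),
    Finset.sum_apply]
  refine Finset.sum_congr rfl fun mu _ => ?_
  rw [Pi.smul_apply, aeval_schurP mu (x N) fun i j h => (sub_ne_zero.2 ((hx N).ne h)).isUnit]

variable [∀ N, Algebra (MvPolynomial (Fin N) ℚ) (K N)]
  [∀ N, IsFractionRing (MvPolynomial (Fin N) ℚ) (K N)]

theorem aeval_fractionVar (N : ℕ) (f : MvPolynomial (Fin N) ℚ) :
    aeval (fractionVar K N) f = algebraMap (MvPolynomial (Fin N) ℚ) (K N) f := by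
  have : (aeval (fractionVar K N) : MvPolynomial (Fin N) ℚ →ₐ[ℚ] K N).toRingHom =
      algebraMap (MvPolynomial (Fin N) ℚ) (K N) := by
    refine ringHom_ext (fun r => ?_) fun i => ?_
    · change aeval (fractionVar K N) (C r) = ((algebraMap _ (K N)).comp C) r
      rw [aeval_C, eq_ratCast, eq_ratCast]
    · exact aeval_X _ i
  exact RingHom.congr_fun this f

end

-- The `ε`-coefficient of `P_lam(x, ε)` is known in two ways: as an element `g` of `Γ` whose
-- specialization is `|lam|` times that of `P_lam`, and as the weighted sum over removed boxes. They
-- agree because `Γ` embeds in the families of rational functions.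
open TrivSqZeroExt in
theorem size_mul_expSpec_schurP_aux (K : ℕ → Type) [∀ N, Field (K N)] [∀ N, CharZero (K N)]
    [∀ N, Algebra (MvPolynomial (Fin N) ℚ) (K N)]
    [∀ N, IsFractionRing (MvPolynomial (Fin N) ℚ) (K N)] (lam : StrictPartition) :
    lam.size * expSpec (schurP lam) =
      ∑ mu ∈ downSet lam, lowerWeight lam.parts mu.parts * expSpec (schurP mu) := by
  have hx0 : ∀ N i, fractionVar K N i ≠ 0 := fun N i h =>
    fractionVar_add_ne_zero N i i (by rw [h, add_zero])
  obtain ⟨g, h1, h2⟩ := dual_of_mem_span (fractionVar K) (schurP_mem_span lam)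
  rw [← h1]
  have hg : g = ∑ mu ∈ downSet lam, lowerWeight lam.parts mu.parts • schurP mu := by
    refine toFraction_injective K (_root_.funext fun N => ?_)
    have h3 := congrArg TrivSqZeroExt.snd (h2 N)
    rw [snd_add, snd_inl, snd_inr, zero_add, dual_schurP fractionVar_injective hx0] at h3
    simp only [aeval_fractionVar] at h3
    rw [map_sum, Finset.sum_apply]
    simp only [map_nsmul, Pi.smul_apply]
    exact h3.symm
  rw [hg, map_sum]
  refine Finset.sum_congr rfl fun mu _ => ?_
  rw [map_nsmul, nsmul_eq_mul]

theorem size_mul_expSpec_schurP (lam : StrictPartition) :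
    lam.size * expSpec (schurP lam) =
      ∑ mu ∈ downSet lam, lowerWeight lam.parts mu.parts * expSpec (schurP mu) :=
  size_mul_expSpec_schurP_aux RationalFn lam

theorem length_of_mem_lower {a : List ℕ} (ha : ∀ i ∈ a, 0 < i) (hs : a.Pairwise (· > ·)) :
    ∀ b ∈ lower a, b.length = a.length ∨ b.length + 1 = a.length := by
  induction a with
  | nil => simp [lower]
  | cons k a ih =>
    rw [List.pairwise_cons] at hs
    intro b hb
    simp only [lower, List.mem_cons, List.mem_map] at hb
    obtain rfl | ⟨c, hc, rfl⟩ := hb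
    · split_ifs <;> simp
    · have := ih (fun i hi => ha i (by simp [hi])) hs.2 c hc
      simpa using this

theorem StrictPartition.length_le_size (lam : StrictPartition) : lam.length ≤ lam.size :=
  List.length_le_sum_of_one_le _ lam.pos

/-- The exponential specialization of a Schur `P`-function. -/
theorem factorial_mul_expSpec_schurP (n : ℕ) : ∀ lam : StrictPartition, lam.size = n →
    (n.factorial : ℚ) * expSpec (schurP lam) = 2 ^ (n - lam.length) * numTableaux lam := by
  simp only [numTableaux_eq_pathCount]
  induction n with
  | zero =>
    intro lam h
    have hnil : lam = StrictPartition.empty := by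
      refine StrictPartition.ext (List.eq_nil_iff_forall_not_mem.2 fun i hi => ?_)
      have := lam.pos i hi
      have := List.sum_eq_zero_iff.1 h i hi
      omega
    have hP : schurP lam = powerSumProd (OddPartition.ones 0) := by
      refine toFraction_injective RationalFn (_root_.funext fun N => ?_)
      refine (symmetrizationFun_spec isGraded_pow.of_eq lam N).trans ?_
      change _ = algebraMap (MvPolynomial (Fin N) ℚ) (RationalFn N)
        ((powerSumProd (OddPartition.ones 0)).1 N)
      rw [powerSumProd_apply, hnil]
      simp [StrictPartition.empty, OddPartition.ones]
    rw [hP, expSpec_powerSumProd, hnil, if_pos (by simp [OddPartition.ones])]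
    simp [StrictPartition.empty, StrictPartition.size, pathCount]
  | succ n ih =>
    intro lam h
    have hrec := size_mul_expSpec_schurP lam
    rw [Nat.factorial_succ, Nat.cast_mul, mul_comm ((n + 1 : ℕ) : ℚ), mul_assoc, ← h, hrec, h,
      pathCount_succ, Nat.cast_sum, Finset.mul_sum, Finset.mul_sum]
    refine Finset.sum_congr rfl fun mu hmu => ?_
    have hcov := mem_downSet.1 hmu
    have hsize : mu.size = n := by
      have := hcov.size_eq
      omega
    have hih := ih mu hsize
    rw [hsize] at hih
    rw [mul_left_comm, hih, ← mul_assoc]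
    congr 1
    have hlen := length_of_mem_lower lam.pos lam.sorted mu.parts
      ((covers_iff_mem_lower mu lam).1 hcov)
    have hle : mu.parts.length ≤ n := hsize ▸ mu.length_le_size
    rw [StrictPartition.length, StrictPartition.length, lowerWeight]
    -- The exponent `n - ℓ` grows by one exactly when the length is unchanged, which is when the
    -- weight is `2`.
    rcases hlen with hlen | hlen
    · rw [if_pos hlen, ← hlen, Nat.succ_sub hle, pow_succ]
      push_cast
      ring
    · rw [if_neg (by omega), ← hlen, Nat.add_sub_add_right]
      simp

/-! ### The averages of supersymmetric functions -/

/-- The shifted Plancherel average as a linear functional on `Γ`. -/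
def averageHom (n : ℕ) : Supersym →ₗ[ℚ] ℚ :=
  ∑ lam ∈ strictPartitionsOf n, plancherelWeight n lam • (evalHom lam).toLinearMap

theorem averageHom_eq_sum (n : ℕ) (f : Supersym) : averageHom n f =
    ∑ lam ∈ strictPartitionsOf n, plancherelWeight n lam * evalHom lam f := by
  simp [averageHom, LinearMap.sum_apply]

theorem averageHom_apply (n : ℕ) (f : Supersym) :
    averageHom n f = plancherelAverage n (evalAt f) := by
  simp only [averageHom_eq_sum, plancherelAverage, evalHom_apply]

/-- For `n < |mu|` both sides vanish. Otherwise one factor `g^lam` of the weight cancels against the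
denominator of `P*_mu(lam)`, and what remains is `n^{↓|mu|} ∑ g^{lam/mu} expSpec (P_lam)`. -/
theorem averageHom_factorialSchurP (n : ℕ) (mu : StrictPartition) :
    averageHom n (factorialSchurP mu) = n.descFactorial mu.size * expSpec (schurP mu) := by
  rw [averageHom_eq_sum]
  obtain hlt | hle := lt_or_ge n mu.size
  · rw [Nat.descFactorial_of_lt hlt, Nat.cast_zero, zero_mul]
    refine Finset.sum_eq_zero fun lam hlam => ?_
    have hs := mem_strictPartitionsOf.1 hlam
    rw [evalHom_factorialSchurP_eq_zero (by omega) (by rintro rfl; omega), mul_zero]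
  · obtain ⟨m, rfl⟩ := Nat.exists_eq_add_of_le hle
    -- Inserting `p_1^m`, which `expSpec` does not see, spreads `P_mu` over the strict partitions of
    -- `n`, so the two sides can be compared term by term.
    rw [← expSpec_psumOne_pow_mul m (schurP mu), psumOne_pow_mul_schurP, map_sum, Finset.mul_sum]
    refine Finset.sum_congr rfl fun lam hlam => ?_
    have hs := mem_strictPartitionsOf.1 hlam
    have h1 := factorial_mul_evalHom m mu lam hs
    have h2 := numTableaux_mul_evalHom lam
    have h3 := factorial_mul_expSpec_schurP (mu.size + m) lam hs
    have h4 : ((mu.size + m - mu.size).factorial : ℚ) *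
        ((mu.size + m).descFactorial mu.size : ℕ) = (mu.size + m).factorial := by
      exact_mod_cast Nat.factorial_mul_descFactorial hle
    rw [Nat.add_sub_cancel_left] at h4
    rw [hs] at h2
    have hm : (m.factorial : ℚ) ≠ 0 := Nat.cast_ne_zero.2 m.factorial_ne_zero
    have hn : ((mu.size + m).factorial : ℚ) ≠ 0 := Nat.cast_ne_zero.2 (Nat.factorial_ne_zero _)
    rw [map_nsmul, nsmul_eq_mul, plancherelWeight, div_mul_eq_mul_div, div_eq_iff hn]
    refine mul_left_cancel₀ hm ?_
    -- The relations used are, with `n = |lam|`: `m! P*_mu(lam) = g^{lam/mu} P*_lam(lam)`, `g^lam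
    -- P*_lam(lam) = n!`, `n! expSpec (P_lam) = 2^{n-ℓ} g^lam` and `m! n^{↓|mu|} = n!`.
    linear_combination (2 ^ (mu.size + m - lam.length) * (numTableaux lam : ℚ) ^ 2) * h1 +
      2 ^ (mu.size + m - lam.length) * (numTableaux lam : ℚ) * (pathCount m mu lam : ℚ) * h2 -
      (pathCount m mu lam : ℚ) * (mu.size + m).factorial * h3 -
      (pathCount m mu lam : ℚ) * expSpec (schurP lam) * (mu.size + m).factorial * h4

-- `p_rho` is a combination of `P_lam` with `|lam| = |rho|` only, so the same factor `n^{↓|rho|}`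
-- comes out of every term and `expSpec (p_rho)` remains.
open Classical in
theorem averageHom_frakp (n : ℕ) (rho : OddPartition) : averageHom n (frakp rho) =
    if ∀ i ∈ rho.parts, i = 1 then (n.descFactorial rho.size : ℚ) else 0 := by
  have key : ∀ f ∈ Submodule.span ℚ (schurP '' {lam | lam.size = rho.size}),
      averageHom n (Psi f) = n.descFactorial rho.size * expSpec f := by
    intro f hf
    induction hf using Submodule.span_induction with
    | mem f hf =>
      obtain ⟨lam, hlam, rfl⟩ := hf
      rw [Psi_schurP, averageHom_factorialSchurP, hlam]
    | zero => simp
    | add f g _ _ h h' => rw [map_add, map_add, map_add, h, h', mul_add]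
    | smul a f _ h => rw [map_smul, map_smul, map_smul, h, smul_eq_mul, smul_eq_mul, mul_left_comm]
  rw [frakp, key _ (powerSumProd_mem_span isGraded_pow isGraded_pow.of_eq rho),
    expSpec_powerSumProd, mul_ite, mul_one, mul_zero]

/-! ### The averages as polynomials in `n`, and their degree -/

theorem OddPartition.size_ones (r : ℕ) : (OddPartition.ones r).size = r := by
  simp [OddPartition.ones, OddPartition.size]

theorem OddPartition.ones_injective : Function.Injective OddPartition.ones := fun r s h => by
  rw [← OddPartition.size_ones r, h, OddPartition.size_ones]

theorem OddPartition.eq_ones_iff (rho : OddPartition) :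
    (∀ i ∈ rho.parts, i = 1) ↔ rho ∈ Set.range OddPartition.ones := by
  constructor
  · intro h
    exact ⟨rho.parts.length, OddPartition.ext (List.eq_replicate_of_mem h).symm⟩
  · rintro ⟨r, rfl⟩ i hi
    exact List.eq_of_mem_replicate hi

/-- The numbers `r` for which `p_1 ^ r` occurs in a linear combination of power sum products. -/
def onesSupport (a : OddPartition →₀ ℚ) : Finset ℕ :=
  a.support.preimage OddPartition.ones OddPartition.ones_injective.injOn

theorem averageHom_eq_sum_onesSupport (n : ℕ) (f : Supersym) :
    averageHom n f = ∑ r ∈ onesSupport (frakpBasis.repr f),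
      frakpBasis.repr f (OddPartition.ones r) * n.descFactorial r := by
  classical
  conv_lhs => rw [← frakpBasis.linearCombination_repr f, Finsupp.linearCombination_apply,
    Finsupp.sum, map_sum]
  simp only [map_smul, frakpBasis_apply, averageHom_frakp, smul_eq_mul]
  have h := Finset.sum_preimage OddPartition.ones (frakpBasis.repr f).support
    OddPartition.ones_injective.injOn (fun rho => frakpBasis.repr f rho *
      if ∀ i ∈ rho.parts, i = 1 then (n.descFactorial rho.size : ℚ) else 0)
    fun rho _ hrho => by rw [if_neg (mt rho.eq_ones_iff.1 hrho), mul_zero]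
  rw [← h, onesSupport]
  refine Finset.sum_congr rfl fun r _ => ?_
  rw [if_pos ((OddPartition.eq_ones_iff _).2 ⟨r, rfl⟩), OddPartition.size_ones]

theorem averageHom_eq_finsum (n : ℕ) (f : Supersym) : averageHom n f =
    ∑ᶠ r : ℕ, frakpBasis.repr f (OddPartition.ones r) * (n.descFactorial r : ℚ) := by
  rw [averageHom_eq_sum_onesSupport, eq_comm]
  refine finsum_eq_sum_of_support_subset _ fun r hr => ?_
  rw [onesSupport, Finset.coe_preimage, Set.mem_preimage, Finset.mem_coe, Finsupp.mem_support_iff]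
  exact left_ne_zero_of_mul hr

/-- The polynomial in `n` whose values are the averages of a supersymmetric function. -/
def averagePolynomial (a : OddPartition →₀ ℚ) : Polynomial ℚ :=
  ∑ r ∈ onesSupport a, Polynomial.C (a (OddPartition.ones r)) * descPochhammer ℚ r

theorem eval_averagePolynomial (n : ℕ) (f : Supersym) :
    (averagePolynomial (frakpBasis.repr f)).eval (n : ℚ) = averageHom n f := by
  rw [averageHom_eq_sum_onesSupport, averagePolynomial, Polynomial.eval_finsetSum]
  refine Finset.sum_congr rfl fun r _ => ?_
  rw [Polynomial.eval_mul, Polynomial.eval_C, descPochhammer_eval_eq_descFactorial]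

theorem two_mul_degree_averagePolynomial_le (a : OddPartition →₀ ℚ) :
    2 * (averagePolynomial a).degree ≤ degOne a := by
  obtain h0 | h0 := eq_or_ne (averagePolynomial a) 0
  · rw [h0, Polynomial.degree_zero, WithBot.mul_bot two_ne_zero]
    exact bot_le
  -- The degree of a sum is at most that of some summand, and the summand of index `r` has degree at
  -- most `r`. For `rho = (1^r)` the quantity in `degOne` is `r + r`, which explains the factor `2`.
  obtain ⟨r, hr, hdeg⟩ : ∃ r ∈ onesSupport a, (averagePolynomial a).natDegree ≤ r := by
    by_contra! h
    refine lt_irrefl (averagePolynomial a).degree ?_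
    nth_rewrite 1 [averagePolynomial]
    refine (Polynomial.degree_sum_le _ _).trans_lt ?_
    rw [Finset.sup_lt_iff (bot_lt_iff_ne_bot.2 (Polynomial.degree_ne_bot.2 h0))]
    intro r hr
    rw [Polynomial.degree_eq_natDegree h0]
    refine lt_of_le_of_lt Polynomial.degree_le_natDegree (WithBot.coe_lt_coe.2 ?_)
    refine lt_of_le_of_lt (Polynomial.natDegree_C_mul_le _ _) ?_
    rw [descPochhammer_natDegree]
    exact h r hr
  rw [onesSupport, Finset.mem_preimage] at hr
  have hle := Finset.le_sup (f := fun rho : OddPartition =>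
    ((rho.size + rho.mult 1 : ℕ) : WithBot ℕ)) hr
  refine le_trans ?_ hle
  have hm : (OddPartition.ones r).mult 1 = r := by simp [OddPartition.ones, OddPartition.mult]
  rw [Polynomial.degree_eq_natDegree h0]
  rw [OddPartition.size_ones, hm]
  have : 2 * (averagePolynomial a).natDegree ≤ r + r := by omega
  exact_mod_cast this

end ShiftedPlancherel

end

theorem proposition4p6 :
    ∃ b : Module.Basis ShiftedPlancherel.OddPartition ℚ ShiftedPlancherel.Supersym,
      (∀ rho, b rho = ShiftedPlancherel.frakp rho) ∧
      ∀ f : ShiftedPlancherel.Supersym,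
        (∀ n : ℕ, ShiftedPlancherel.plancherelAverage n (ShiftedPlancherel.evalAt f) =
          ∑ᶠ r : ℕ, b.repr f (ShiftedPlancherel.OddPartition.ones r) *
            (n.descFactorial r : ℚ)) ∧
        ∃ q : Polynomial ℚ,
          (∀ n : ℕ, ShiftedPlancherel.plancherelAverage n (ShiftedPlancherel.evalAt f) =
            q.eval (n : ℚ)) ∧
          2 * q.degree ≤ ShiftedPlancherel.degOne (b.repr f) := by
  open ShiftedPlancherel in
  refine ⟨frakpBasis, frakpBasis_apply, fun f => ⟨fun n => ?_, ?_⟩⟩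
  · rw [← averageHom_apply, averageHom_eq_finsum]
  · refine ⟨averagePolynomial (frakpBasis.repr f), fun n => ?_,
      two_mul_degree_averagePolynomial_le _⟩
    rw [eval_averagePolynomial, averageHom_apply]
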